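/- Let $\Omega\subset\mathbb R^n$ be a bounded open set of class $C^\infty$, and let $\Omega'$ be open with $\overline{\Omega'}\subset\Omega$ compact. All functions and distributions are complex valued. For $0\le k\le\infty$, $1\le p\le\infty$ let $W^{k,p}(\Omega)\subset\mathcal D'(\Omega)$ be the Sobolev space of distributions all of whose derivatives of (finite) order at most $k$ lie in $L^p(\Omega)$, let $\mathcal E'(\Omega')\subset\mathcal D'(\Omega)$ be the space of distributions whose support is a compact subset of $\Omega'$, and put $$\mathcal F'(\Omega)=\mathcal E'(\Omega')+\bigcup_{0\le k\le\infty,\ 1\le p\le\infty}W^{k,p}(\Omega)\subset\mathcal D'(\Omega).$$ Let $E$ be a total extension operator for $\Omega$ extended to $\mathcal E'(\Omega')$, that is, a map from $\mathcal E'(\Omega')\cup\bigcup_{k,p}W^{k,p}(\Omega)$ to $\mathcal D'(\mathbb R^n)$ such that * for all $0\le k\le\infty$, $1\le p\le\infty$, $E$ is linear on $W^{k,p}(\Omega)$, maps it into $W^{k,p}(\mathbb R^n)$, and satisfies $E(u)|_\Omega=u$; and for all finite $k$ there is a constant $C_{k,p}$ with $\|Eu\|_{W^{k,p}(\mathbb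 R^n)}\le C_{k,p}\|u\|_{W^{k,p}(\Omega)}$ for all $u\in W^{k,p}(\Omega)$; * $E$ is linear on $\mathcal E'(\Omega')$, and for $u\in\mathcal E'(\Omega')$, $E(u)|_\Omega=u$ and $E(u)$ vanishes on a neighbourhood of $\mathbb R^n\setminus\Omega$. Let $\psi\in\mathcal S(\mathbb R^n)$ with $\psi\equiv1$ on a neighbourhood of $0$, let $\phi=\mathcal F^{-1}[\psi]$ (so that $\int\phi=1$ and $\int x^\alpha\phi\,dx=0$ for all $|\alpha|\ge1$), and let $\phi_\epsilon(x)=\epsilon^{-n}\phi(x/\epsilon)$ for $\epsilon\in(0,1]$. Let $C^\infty(\overline\Omega)$ be the space of functions that are smooth in $\Omega$ and have all derivatives extending continuously to $\overline\Omega$, with the seminorms $\mu_k(f)=\sup\{|D^\alpha f(x)|:|\alpha|\le k,\ x\in\overline\Omega\}$. Let $\mathcal E_M(\overline\Omega)$ be the space of nets $(u_\epsilon)_{\epsilon\in(0,1]}$ in $C^\infty(\overline\Omega)$ such that for every $k\in\mathbb N$ there is $a\in\mathbb R$ with $\mu_k(u_\epsilon)=\mathcal O(\epsilon^a)$ as $\epsilon\to0$,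 let $\mathcal N(\overline\Omega)$ be the subspace of those nets for which this holds for every $k$ and every $a\in\mathbb R$, and let $\mathcal G(\overline\Omega)=\mathcal E_M(\overline\Omega)/\mathcal N(\overline\Omega)$. Then $E$ extends uniquely to a linear map $E:\mathcal F'(\Omega)\to\mathcal D'(\mathbb R^n)$. For every $u\in\mathcal F'(\Omega)$ the distribution $E(u)$ is tempered and the net $\left((E(u)*\phi_\epsilon)|_{\overline\Omega}\right)_{\epsilon}$ belongs to $\mathcal E_M(\overline\Omega)$, and $$i:\mathcal F'(\Omega)\to\mathcal G(\overline\Omega),\qquad i(u)=\left.(E(u)*\phi_\epsilon)\right|_{\overline\Omega}+\mathcal N(\overline\Omega),$$ is a well-defined, linear and injective map. -/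

import Mathlib

open MeasureTheory Filter Topology TopologicalSpace Set Asymptotics
open scoped ENNReal NNReal Distributions SchwartzMap LineDeriv FourierTransform

noncomputable section

namespace Colombeau

/-! ### Generalized extensions `𝒢_V = ℰ_{M,V} / 𝒩_V` -/

section GeneralizedExtension

variable {V : Type*} [AddCommGroup V] [Module ℂ V]

/-- The filter "`ε → 0`" on the index set `I = (0, 1]`. -/
def zeroFilter : Filter (Ioc (0 : ℝ) 1) := comap Subtype.val (𝓝 0)

/-- `x_ε = O(ε ^ a)` as `ε → 0`, for a net of real numbers. -/
def IsOrder (x : Ioc (0 : ℝ) 1 → ℝ) (a : ℝ) : Prop :=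
  x =O[zeroFilter] fun ε => (ε : ℝ) ^ a

theorem IsOrder.mono {x : Ioc (0 : ℝ) 1 → ℝ} {a b : ℝ} (h : IsOrder x a) (hb : b ≤ a) :
    IsOrder x b := by
  refine IsBigO.trans h (IsBigO.of_bound 1 (Eventually.of_forall fun ε => ?_))
  rw [one_mul, Real.norm_of_nonneg (Real.rpow_nonneg ε.2.1.le _),
    Real.norm_of_nonneg (Real.rpow_nonneg ε.2.1.le _)]
  exact Real.rpow_le_rpow_of_exponent_ge ε.2.1 ε.2.2 hb

theorem IsOrder.zero (p : Seminorm ℂ V) (a : ℝ) :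
    IsOrder (fun ε => p ((0 : Ioc (0 : ℝ) 1 → V) ε)) a := by
  simpa [IsOrder] using isBigO_zero (fun ε : Ioc (0 : ℝ) 1 => (ε : ℝ) ^ a) zeroFilter

theorem IsOrder.add (p : Seminorm ℂ V) {u v : Ioc (0 : ℝ) 1 → V} {a : ℝ}
    (hu : IsOrder (fun ε => p (u ε)) a) (hv : IsOrder (fun ε => p (v ε)) a) :
    IsOrder (fun ε => p ((u + v) ε)) a := by
  refine IsBigO.trans (IsBigO.of_bound 1 (Eventually.of_forall fun ε => ?_)) (IsBigO.add hu hv)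
  rw [one_mul, Real.norm_of_nonneg (apply_nonneg p _),
    Real.norm_of_nonneg (add_nonneg (apply_nonneg p _) (apply_nonneg p _))]
  exact map_add_le_add p _ _

theorem IsOrder.smul (p : Seminorm ℂ V) {u : Ioc (0 : ℝ) 1 → V} {a : ℝ} (c : ℂ)
    (hu : IsOrder (fun ε => p (u ε)) a) : IsOrder (fun ε => p ((c • u) ε)) a := by
  simp only [Pi.smul_apply, map_smul_eq_mul]
  exact IsBigO.const_mul_left hu _

/-- The moderate nets `ℰ_{M,V}`, for the family `μ` of seminorms on `V`. -/
def Moderate (μ : ℕ → Seminorm ℂ V) : Submodule ℂ (Ioc (0 : ℝ) 1 → V) where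
  carrier := {u | ∀ k, ∃ a : ℝ, IsOrder (fun ε => μ k (u ε)) a}
  zero_mem' _ := ⟨0, IsOrder.zero _ _⟩
  add_mem' {u v} hu hv k := by
    obtain ⟨a, ha⟩ := hu k
    obtain ⟨b, hb⟩ := hv k
    exact ⟨min a b, IsOrder.add _ (ha.mono (min_le_left _ _)) (hb.mono (min_le_right _ _))⟩
  smul_mem' c u hu k := by
    obtain ⟨a, ha⟩ := hu k
    exact ⟨a, IsOrder.smul _ c ha⟩

/-- The null nets `𝒩_V`, as a subspace of the moderate nets. -/
def Null (μ : ℕ → Seminorm ℂ V) : Submodule ℂ (Moderate μ) where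
  carrier := {u | ∀ k, ∀ a : ℝ, IsOrder (fun ε => μ k (u.1 ε)) a}
  zero_mem' _ _ := IsOrder.zero _ _
  add_mem' hu hv k a := IsOrder.add _ (hu k a) (hv k a)
  smul_mem' c _ hu k a := IsOrder.smul _ c (hu k a)

/-- The polynomial generalized extension `𝒢_V = ℰ_{M,V} / 𝒩_V`. -/
abbrev GenExt (μ : ℕ → Seminorm ℂ V) : Type _ := Moderate μ ⧸ Null μ

end GeneralizedExtension

variable {n : ℕ}

/-! ### The space `C^∞(Ω̄)` and the algebra `𝒢(Ω̄)`

Multi-indices are written as words: for `w : Fin j → Fin n` the list of vectors `dirs w` stands for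
the partial derivative `D_{w 0} D_{w 1} ⋯` of order `j`. Every `D^α` with `|α| = j` is of this form,
and all words of length `j` give such a `D^α`. -/

/-- The coordinate directions listed by the word `w`. -/
def dirs {j : ℕ} (w : Fin j → Fin n) : Fin j → EuclideanSpace ℝ (Fin n) :=
  fun i => EuclideanSpace.single (w i) 1

/-- The (classical) partial derivative of order `j` of `f` at `x`, given by the word `w`. -/
def partialD {j : ℕ} (w : Fin j → Fin n) (f : EuclideanSpace ℝ (Fin n) → ℂ)
    (x : EuclideanSpace ℝ (Fin n)) : ℂ :=
  iteratedFDeriv ℝ j f x (dirs w)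

variable (Ω : Opens (EuclideanSpace ℝ (Fin n)))

/-- The closed set `Ω̄`. -/
abbrev Cl : Set (EuclideanSpace ℝ (Fin n)) := closure (Ω : Set (EuclideanSpace ℝ (Fin n)))

variable {Ω}

/-- The extension by zero of a function on `Ω̄` (only used to differentiate it inside `Ω`). -/
def ext0 (f : Cl Ω → ℂ) : EuclideanSpace ℝ (Fin n) → ℂ := Function.extend Subtype.val f 0

theorem ext0_add (f g : Cl Ω → ℂ) : ext0 (f + g) = ext0 f + ext0 g := by
  have := Function.extend_add (Subtype.val : Cl Ω → EuclideanSpace ℝ (Fin n)) f g 0 0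
  simpa [ext0] using this

theorem ext0_smul (c : ℂ) (f : Cl Ω → ℂ) : ext0 (c • f) = c • ext0 f := by
  have := Function.extend_smul c (Subtype.val : Cl Ω → EuclideanSpace ℝ (Fin n)) f 0
  simpa [ext0] using this

theorem ext0_zero : ext0 (0 : Cl Ω → ℂ) = 0 := by
  have := ext0_smul (0 : ℂ) (0 : Cl Ω → ℂ)
  simpa using this

theorem partialD_add {j : ℕ} (w : Fin j → Fin n) {f g : Cl Ω → ℂ}
    (hf : ContDiffOn ℝ (⊤ : ℕ∞) (ext0 f) Ω) (hg : ContDiffOn ℝ (⊤ : ℕ∞) (ext0 g) Ω) {x}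
    (hx : x ∈ Ω) : partialD w (ext0 (f + g)) x = partialD w (ext0 f) x + partialD w (ext0 g) x := by
  have h1 := (hf.contDiffAt (Ω.isOpen.mem_nhds hx)).of_le
    (show ((j : ℕ) : WithTop ℕ∞) ≤ ((⊤ : ℕ∞) : WithTop ℕ∞) from mod_cast le_top)
  have h2 := (hg.contDiffAt (Ω.isOpen.mem_nhds hx)).of_le
    (show ((j : ℕ) : WithTop ℕ∞) ≤ ((⊤ : ℕ∞) : WithTop ℕ∞) from mod_cast le_top)
  rw [ext0_add, partialD, iteratedFDeriv_add_apply h1 h2]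
  rfl

theorem partialD_smul {j : ℕ} (w : Fin j → Fin n) {f : Cl Ω → ℂ} (c : ℂ)
    (hf : ContDiffOn ℝ (⊤ : ℕ∞) (ext0 f) Ω) {x}
    (hx : x ∈ Ω) : partialD w (ext0 (c • f)) x = c • partialD w (ext0 f) x := by
  have h1 := (hf.contDiffAt (Ω.isOpen.mem_nhds hx)).of_le
    (show ((j : ℕ) : WithTop ℕ∞) ≤ ((⊤ : ℕ∞) : WithTop ℕ∞) from mod_cast le_top)
  rw [ext0_smul, partialD, iteratedFDeriv_const_smul_apply h1]
  rfl

variable (Ω)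

/-- `C^∞(Ω̄)`: the continuous functions on `Ω̄` that are smooth in `Ω` and all of whose partial
derivatives extend from `Ω` to (bounded) continuous functions on `Ω̄`. Boundedness is automatic
when `Ω` is bounded. -/
def CInf : Submodule ℂ (Cl Ω → ℂ) where
  carrier := {f | Continuous f ∧ ContDiffOn ℝ (⊤ : ℕ∞) (ext0 f) Ω ∧
    ∀ (j : ℕ) (w : Fin j → Fin n), ∃ g : BoundedContinuousFunction (Cl Ω) ℂ,
      ∀ x : Cl Ω, x.1 ∈ Ω → g x = partialD w (ext0 f) x}
  zero_mem' := by
    refine ⟨continuous_zero, by rw [ext0_zero]; exact contDiffOn_const, fun j w => ⟨0, ?_⟩⟩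
    intro x _
    rw [ext0_zero, partialD]
    simp [Pi.zero_def]
  add_mem' {f g} hf hg := by
    obtain ⟨hf1, hf2, hf3⟩ := hf
    obtain ⟨hg1, hg2, hg3⟩ := hg
    refine ⟨hf1.add hg1, by rw [ext0_add]; exact hf2.add hg2, fun j w => ?_⟩
    obtain ⟨a, ha⟩ := hf3 j w
    obtain ⟨b, hb⟩ := hg3 j w
    refine ⟨a + b, fun x hx => ?_⟩
    rw [partialD_add w hf2 hg2 hx, ← ha x hx, ← hb x hx]
    rfl
  smul_mem' c f hf := by
    obtain ⟨hf1, hf2, hf3⟩ := hf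
    refine ⟨hf1.const_smul c, by rw [ext0_smul]; exact hf2.const_smul c, fun j w => ?_⟩
    obtain ⟨a, ha⟩ := hf3 j w
    refine ⟨c • a, fun x hx => ?_⟩
    rw [partialD_smul w c hf2 hx, ← ha x hx]
    rfl

variable {Ω}

theorem CInf.bdd (f : CInf Ω) {j : ℕ} (w : Fin j → Fin n) :
    BddAbove (range fun x : Ω => ‖partialD w (ext0 f.1) x‖) := by
  obtain ⟨g, hg⟩ := f.2.2.2 j w
  refine ⟨‖g‖, ?_⟩
  rintro _ ⟨x, rfl⟩
  have := hg ⟨x.1, subset_closure x.2⟩ x.2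
  simp only at this ⊢
  rw [← this]
  exact g.norm_coe_le_norm _

variable (Ω)

/-- `f ↦ sup_Ω |D_w f|`. By continuity this is also the supremum over `Ω̄` of the continuous
extension of `D_w f`. -/
def supSeminorm {j : ℕ} (w : Fin j → Fin n) : Seminorm ℂ (CInf Ω) :=
  Seminorm.of (fun f => ⨆ x : Ω, ‖partialD w (ext0 f.1) x‖)
    (fun f g => by
      have h0 : 0 ≤ (⨆ x : Ω, ‖partialD w (ext0 f.1) x‖) + ⨆ x : Ω, ‖partialD w (ext0 g.1) x‖ :=
        add_nonneg (Real.iSup_nonneg fun _ => norm_nonneg _) (Real.iSup_nonneg fun _ => norm_nonneg _)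
      refine Real.iSup_le (fun x => ?_) h0
      have : partialD w (ext0 (f + g).1) x = partialD w (ext0 f.1) x + partialD w (ext0 g.1) x :=
        partialD_add w f.2.2.1 g.2.2.1 x.2
      rw [this]
      exact (norm_add_le _ _).trans (add_le_add (le_ciSup (CInf.bdd f w) x)
        (le_ciSup (CInf.bdd g w) x)))
    (fun c f => by
      rw [Real.mul_iSup_of_nonneg (norm_nonneg c)]
      congr 1
      funext x
      have : partialD w (ext0 (c • f).1) x = c • partialD w (ext0 f.1) x :=
        partialD_smul w c f.2.2.1 x.2
      rw [this, norm_smul])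

/-- The seminorms `μ_k(f) = sup {|D^α f(x)| : |α| ≤ k, x ∈ Ω̄}` on `C^∞(Ω̄)`. -/
def muCl (k : ℕ) : Seminorm ℂ (CInf Ω) :=
  (Finset.range (k + 1)).sup fun j => Finset.univ.sup fun w : Fin j → Fin n => supSeminorm Ω w

/-- The moderate nets `ℰ_M(Ω̄)`. -/
abbrev ModerateCl : Submodule ℂ (Ioc (0 : ℝ) 1 → CInf Ω) := Moderate (muCl Ω)

/-- The generalized extension `𝒢(Ω̄) = ℰ_M(Ω̄) / 𝒩(Ω̄)`. -/
abbrev GCl : Type := GenExt (muCl Ω)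

/-- The class in `𝒢(Ω̄)` of a moderate net. -/
def classCl (u : ModerateCl Ω) : GCl Ω := Submodule.Quotient.mk u

/-! ### Domains of class `C^∞` -/

/-- `Ω` is of class `C^k` for every `k`: near each boundary point there is a `C^k` diffeomorphism
of a ball onto an open set that maps the part of the ball in `Ω` into an open half space and the
part in `∂Ω` into the bounding hyperplane. -/
def IsSmoothClass : Prop :=
  ∀ k : ℕ, ∀ x₀ ∈ frontier (Ω : Set (EuclideanSpace ℝ (Fin n))),
    ∃ (r : ℝ) (Ψ : OpenPartialHomeomorph (EuclideanSpace ℝ (Fin n)) (EuclideanSpace ℝ (Fin n)))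
      (i : Fin n),
      0 < r ∧ Ψ.source = Metric.ball x₀ r ∧
      (∀ x ∈ Metric.ball x₀ r, x ∈ Ω → 0 < Ψ x i) ∧
      (∀ x ∈ Metric.ball x₀ r, x ∈ frontier (Ω : Set (EuclideanSpace ℝ (Fin n))) → Ψ x i = 0) ∧
      ContDiffOn ℝ k Ψ Ψ.source ∧ ContDiffOn ℝ k Ψ.symm Ψ.target

/-! ### Distributions: Sobolev spaces, compact support -/

variable {Ω} in
/-- The distribution `T` on `Ω` is (given by) the function `f ∈ L^p(Ω)`. -/
def IsLpFun (p : ℝ≥0∞) (T : 𝓓'(Ω, ℂ)) (f : EuclideanSpace ℝ (Fin n) → ℂ) : Prop :=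
  MemLp f p (volume.restrict (Ω : Set (EuclideanSpace ℝ (Fin n)))) ∧
    ∀ θ : 𝓓(Ω, ℝ), T θ = ∫ x in (Ω : Set (EuclideanSpace ℝ (Fin n))), θ x • f x

variable {Ω} in
theorem IsLpFun.integrable {p : ℝ≥0∞} [hp : Fact (1 ≤ p)] {T : 𝓓'(Ω, ℂ)}
    {f : EuclideanSpace ℝ (Fin n) → ℂ} (h : IsLpFun p T f) (θ : 𝓓(Ω, ℝ)) :
    Integrable (fun x => θ x • f x) (volume.restrict (Ω : Set (EuclideanSpace ℝ (Fin n)))) :=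
  (h.1.locallyIntegrable hp.out).integrable_smul_left_of_hasCompactSupport θ.continuous
    θ.hasCompactSupport

variable {Ω} in
theorem iteratedLineDerivOp_complex_smul (c : ℂ) (T : 𝓓'(Ω, ℂ)) {j : ℕ}
    (m : Fin j → EuclideanSpace ℝ (Fin n)) : ∂^{m} (c • T) = c • ∂^{m} T := by
  induction j with
  | zero => rfl
  | succ j ih =>
    rw [LineDeriv.iteratedLineDerivOp_succ_left, LineDeriv.iteratedLineDerivOp_succ_left, ih]
    ext θ
    change ∂_{m 0} (c • ∂^{Fin.tail m} T) θ = c • (∂_{m 0} (∂^{Fin.tail m} T) θ)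
    rw [Distribution.lineDerivOp_apply_apply, Distribution.lineDerivOp_apply_apply]
    rfl

/-- The Sobolev space `W^{k,p}(Ω)`, `0 ≤ k ≤ ∞`, `1 ≤ p ≤ ∞`, as a space of distributions: all
distributional derivatives of order at most `k` (and finite) are in `L^p(Ω)`. -/
def sobolev (k : ℕ∞) (p : ℝ≥0∞) [Fact (1 ≤ p)] : Submodule ℂ 𝓓'(Ω, ℂ) where
  carrier := {T | ∀ j : ℕ, (j : ℕ∞) ≤ k → ∀ w : Fin j → Fin n, ∃ f, IsLpFun p (∂^{dirs w} T) f}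
  zero_mem' j _ w := ⟨0, MemLp.zero, fun θ => by simp [LineDeriv.iteratedLineDerivOp_zero]⟩
  add_mem' {S T} hS hT j hj w := by
    obtain ⟨f, hf⟩ := hS j hj w
    obtain ⟨g, hg⟩ := hT j hj w
    refine ⟨f + g, hf.1.add hg.1, fun θ => ?_⟩
    rw [LineDeriv.iteratedLineDerivOp_add]
    simp only [Pi.add_apply, smul_add]
    rw [integral_add (hf.integrable θ) (hg.integrable θ), ← hf.2, ← hg.2]
    rfl
  smul_mem' c T hT j hj w := by
    obtain ⟨f, hf⟩ := hT j hj w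
    refine ⟨c • f, hf.1.const_smul c, fun θ => ?_⟩
    rw [iteratedLineDerivOp_complex_smul]
    change c • (∂^{dirs w} T) θ = _
    rw [hf.2, ← integral_smul]
    exact integral_congr_ae (Eventually.of_forall fun x => smul_comm _ _ _)

variable {Ω} in
/-- The `L^p(Ω)` norm of a distribution: the norm of the (a.e. unique) `L^p` function that
represents it, and `∞` if there is none. -/
def distLpNorm (p : ℝ≥0∞) (T : 𝓓'(Ω, ℂ)) : ℝ≥0∞ :=
  ⨅ (f : EuclideanSpace ℝ (Fin n) → ℂ) (_ : IsLpFun p T f),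
    eLpNorm f p (volume.restrict (Ω : Set (EuclideanSpace ℝ (Fin n))))

variable {Ω} in
/-- The norm `max_{|α| ≤ k} ‖D^α u‖_{L^p(Ω)}` of `W^{k,p}(Ω)`. -/
def sobolevNorm (k : ℕ) (p : ℝ≥0∞) (T : 𝓓'(Ω, ℂ)) : ℝ≥0∞ :=
  ⨆ (j : ℕ) (_ : j ≤ k) (w : Fin j → Fin n), distLpNorm p (∂^{dirs w} T)

open Distribution in
/-- `ℰ'(Ω')` for an open `Ω' ⊆ Ω`: the distributions on `Ω` whose support is a compact subset
of `Ω'`. -/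
def compactDist (Ω' : Opens (EuclideanSpace ℝ (Fin n))) : Submodule ℂ 𝓓'(Ω, ℂ) where
  carrier := {T | ∃ K : Set (EuclideanSpace ℝ (Fin n)), IsCompact K ∧ K ⊆ Ω' ∧
    IsVanishingOn T Kᶜ}
  zero_mem' := ⟨∅, isCompact_empty, empty_subset _, fun _ _ => rfl⟩
  add_mem' {S T} hS hT := by
    obtain ⟨K, hK, hKΩ, hS⟩ := hS
    obtain ⟨L, hL, hLΩ, hT⟩ := hT
    refine ⟨K ∪ L, hK.union hL, union_subset hKΩ hLΩ, fun u hu => ?_⟩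
    have h1 : S u = 0 := hS u (hu.trans (compl_subset_compl.2 subset_union_left))
    have h2 : T u = 0 := hT u (hu.trans (compl_subset_compl.2 subset_union_right))
    change S u + T u = 0
    rw [h1, h2, add_zero]
  smul_mem' c T hT := by
    obtain ⟨K, hK, hKΩ, hT⟩ := hT
    refine ⟨K, hK, hKΩ, fun u hu => ?_⟩
    change c • T u = 0
    rw [hT u hu, smul_zero]

/-- `ℱ'(Ω) = ℰ'(Ω') + ⋃_{0 ≤ k ≤ ∞, 1 ≤ p ≤ ∞} W^{k,p}(Ω)`, the subspace of `𝒟'(Ω)` formed by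
the sum. For bounded `Ω` the union is itself a subspace, since every `W^{k,p}(Ω) ⊆ W^{0,1}(Ω)`. -/
def FDist (Ω' : Opens (EuclideanSpace ℝ (Fin n))) : Submodule ℂ 𝓓'(Ω, ℂ) :=
  compactDist Ω Ω' ⊔ ⨆ (k : ℕ∞) (p : ℝ≥0∞) (_ : Fact (1 ≤ p)), sobolev Ω k p

variable {Ω} in
/-- The restriction `U|_Ω` of a distribution `U` on `ℝⁿ` is `T`. -/
def RestrictsTo (U : 𝓓'((⊤ : Opens (EuclideanSpace ℝ (Fin n))), ℂ)) (T : 𝓓'(Ω, ℂ)) : Prop :=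
  ∀ θ : 𝓓(Ω, ℝ), U (TestFunction.monoCLM ℝ θ) = T θ

open Distribution in
/-- `E` is a total extension operator for `Ω` that has been extended to `ℰ'(Ω')`. It is one map,
linear on each `W^{k,p}(Ω)` and on `ℰ'(Ω')`, which maps every `W^{k,p}(Ω)`, `0 ≤ k ≤ ∞`,
`1 ≤ p ≤ ∞`, boundedly into `W^{k,p}(ℝⁿ)` and satisfies `E(u)|_Ω = u` there, and which extends the
elements of `ℰ'(Ω')` by zero outside `Ω`. Its values at other distributions are irrelevant. -/
structure IsTotalExtension (Ω' : Opens (EuclideanSpace ℝ (Fin n)))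
    (E : 𝓓'(Ω, ℂ) → 𝓓'((⊤ : Opens (EuclideanSpace ℝ (Fin n))), ℂ)) : Prop where
  sobolev_add : ∀ (k : ℕ∞) (p : ℝ≥0∞) [Fact (1 ≤ p)], ∀ u ∈ sobolev Ω k p, ∀ v ∈ sobolev Ω k p,
    E (u + v) = E u + E v
  sobolev_smul : ∀ (k : ℕ∞) (p : ℝ≥0∞) [Fact (1 ≤ p)], ∀ (c : ℂ), ∀ u ∈ sobolev Ω k p,
    E (c • u) = c • E u
  sobolev_mem : ∀ (k : ℕ∞) (p : ℝ≥0∞) [Fact (1 ≤ p)], ∀ u ∈ sobolev Ω k p,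
    E u ∈ sobolev (⊤ : Opens (EuclideanSpace ℝ (Fin n))) k p
  sobolev_bound : ∀ (k : ℕ) (p : ℝ≥0∞) [Fact (1 ≤ p)], ∃ C : ℝ≥0, ∀ u ∈ sobolev Ω k p,
    sobolevNorm k p (E u) ≤ C * sobolevNorm k p u
  sobolev_restrict : ∀ (k : ℕ∞) (p : ℝ≥0∞) [Fact (1 ≤ p)], ∀ u ∈ sobolev Ω k p,
    RestrictsTo (E u) u
  compact_add : ∀ u ∈ compactDist Ω Ω', ∀ v ∈ compactDist Ω Ω', E (u + v) = E u + E v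
  compact_smul : ∀ (c : ℂ), ∀ u ∈ compactDist Ω Ω', E (c • u) = c • E u
  compact_restrict : ∀ u ∈ compactDist Ω Ω', RestrictsTo (E u) u
  compact_vanish : ∀ u ∈ compactDist Ω Ω', ∃ U : Set (EuclideanSpace ℝ (Fin n)),
    IsOpen U ∧ (Ω : Set (EuclideanSpace ℝ (Fin n)))ᶜ ⊆ U ∧ IsVanishingOn (E u) U

variable {Ω} in
/-- The linear map `Ê` on `ℱ'(Ω)` agrees with `E` on `ℰ'(Ω')` and on every `W^{k,p}(Ω)`. -/
def ExtendsOp {Ω' : Opens (EuclideanSpace ℝ (Fin n))}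
    (E : 𝓓'(Ω, ℂ) → 𝓓'((⊤ : Opens (EuclideanSpace ℝ (Fin n))), ℂ))
    (Ê : FDist Ω Ω' →ₗ[ℂ] 𝓓'((⊤ : Opens (EuclideanSpace ℝ (Fin n))), ℂ)) : Prop :=
  (∀ u : FDist Ω Ω', (u : 𝓓'(Ω, ℂ)) ∈ compactDist Ω Ω' → Ê u = E u) ∧
  ∀ (k : ℕ∞) (p : ℝ≥0∞) [Fact (1 ≤ p)], ∀ u : FDist Ω Ω', (u : 𝓓'(Ω, ℂ)) ∈ sobolev Ω k p →
    Ê u = E u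

/-! ### Convolution of a tempered distribution with a Schwartz function -/

/-- A test function as a Schwartz function. -/
def testToSchwartz (θ : 𝓓((⊤ : Opens (EuclideanSpace ℝ (Fin n))), ℝ)) :
    𝓢(EuclideanSpace ℝ (Fin n), ℂ) :=
  (θ.hasCompactSupport.comp_left (g := fun t : ℝ => (t : ℂ)) Complex.ofReal_zero).toSchwartzMap
    (Complex.ofRealCLM.contDiff.comp θ.contDiff)

/-- The tempered distribution `S` is an extension of `T ∈ 𝒟'(ℝⁿ)` to the Schwartz functions. -/
def IsTemperedExt (T : 𝓓'((⊤ : Opens (EuclideanSpace ℝ (Fin n))), ℂ))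
    (S : 𝓢'(EuclideanSpace ℝ (Fin n), ℂ)) : Prop :=
  ∀ θ, S (testToSchwartz θ) = T θ

/-- `T ∈ 𝒟'(ℝⁿ)` is tempered. -/
def IsTempered (T : 𝓓'((⊤ : Opens (EuclideanSpace ℝ (Fin n))), ℂ)) : Prop :=
  ∃ S, IsTemperedExt T S

open Classical in
/-- The extension of a tempered `T ∈ 𝒟'(ℝⁿ)` to the Schwartz functions. It is unique, as test
functions are dense in the Schwartz space. -/
def temperedExt (T : 𝓓'((⊤ : Opens (EuclideanSpace ℝ (Fin n))), ℂ)) :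
    𝓢'(EuclideanSpace ℝ (Fin n), ℂ) :=
  if h : IsTempered T then h.choose else 0

/-- The Schwartz function `y ↦ φ (x - y)`. -/
def reflectAt (φ : 𝓢(EuclideanSpace ℝ (Fin n), ℂ)) (x : EuclideanSpace ℝ (Fin n)) :
    𝓢(EuclideanSpace ℝ (Fin n), ℂ) :=
  SchwartzMap.compSubConstCLM ℂ x
    (SchwartzMap.compCLMOfContinuousLinearEquiv ℂ (ContinuousLinearEquiv.neg ℝ) φ)

theorem reflectAt_apply (φ : 𝓢(EuclideanSpace ℝ (Fin n), ℂ)) (x y : EuclideanSpace ℝ (Fin n)) :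
    reflectAt φ x y = φ (x - y) := by
  simp [reflectAt]

/-- The convolution `(T ∗ φ)(x) = ⟨T, φ (x - ·)⟩` of a tempered `T` with a Schwartz function. -/
def schwartzConv (T : 𝓓'((⊤ : Opens (EuclideanSpace ℝ (Fin n))), ℂ))
    (φ : 𝓢(EuclideanSpace ℝ (Fin n), ℂ)) (x : EuclideanSpace ℝ (Fin n)) : ℂ :=
  temperedExt T (reflectAt φ x)

/-- `φ_ε(x) = ε^{-n} φ(x / ε)`. -/
def scaled (φ : 𝓢(EuclideanSpace ℝ (Fin n), ℂ)) (ε : Ioc (0 : ℝ) 1) :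
    𝓢(EuclideanSpace ℝ (Fin n), ℂ) :=
  ((((ε : ℝ) ^ n)⁻¹ : ℝ) : ℂ) • SchwartzMap.compCLMOfContinuousLinearEquiv ℂ
    (ContinuousLinearEquiv.smulLeft (Units.mk0 (ε : ℝ)⁻¹ (inv_ne_zero ε.2.1.ne'))) φ

theorem scaled_apply (φ : 𝓢(EuclideanSpace ℝ (Fin n), ℂ)) (ε : Ioc (0 : ℝ) 1)
    (x : EuclideanSpace ℝ (Fin n)) :
    scaled φ ε x = ((((ε : ℝ) ^ n)⁻¹ : ℝ) : ℂ) * φ ((ε : ℝ)⁻¹ • x) := by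
  rfl

end Colombeau

end

open Colombeau

/-! Extension: on a bounded `Ω` every `W^{k,p}` lies in `W^{0,1}`, so `ℱ'` is the sum of only two
subspaces, `ℰ'(Ω')` and `W^{0,1}`. `E` is linear on each, and its two restrictions agree on the
intersection because they come from one map; hence they glue, uniquely (`exists_extendsOp`,
`ExtendsOp.unique`). `E u` is tempered because it is the sum of an `L^1` function and a distribution
that vanishes off a bounded set.

Moderateness: let `S` be the tempered extension of `E u`. Then `(E u * φ_ε)(x)` is `S` applied to
the translate by `x` of `φ_ε(-·)`. This is smooth in `x`, its derivatives fall on `φ_ε`, and a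
continuity bound of `S` by Schwartz seminorms costs a constant for bounded `x` and a power of `1/ε`
for the dilation (`exists_moderate_bound`).

Injectivity: if the net is null, it tends to `0` uniformly on `Ω`. For a test function `θ` on `Ω`,
`∫ θ (E u * φ_ε) = S(θ * φ_ε(-·))` by `integral_mul_apply_translate`. The left side tends to `0`,
the right side to `S θ = u(θ)`: the Fourier transform of `θ * φ_ε(-·)` is `ψ(-ε·)` times that of
`θ`, which converges in the Schwartz space since `ψ(0) = 1` (`tendsto_conv_scaled`). So `u = 0`. -/

namespace SchwartzMap

variable {V : Type*} [NormedAddCommGroup V]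

/-! ### Schwartz seminorms and Taylor estimates for translations -/

section Seminorm

variable [NormedSpace ℝ V]

/-- Continuity provides a finite set of seminorm indices; enlarging it to a square below `(M, M)`
leaves a single parameter to track. -/
theorem exists_bound_of_continuous_seminorm {q : Seminorm ℂ 𝓢(V, ℂ)} (hq : Continuous q) :
    ∃ (M : ℕ) (C : ℝ), 0 ≤ C ∧
      ∀ g, q g ≤ C * (Finset.Iic (M, M)).sup (schwartzSeminormFamily ℂ V ℂ) g := by
  obtain ⟨s, C, -, h⟩ := Seminorm.bound_of_continuous (schwartz_withSeminorms ℂ V ℂ) q hq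
  refine ⟨s.sup fun i => max i.1 i.2, C, C.2, fun g => (h g).trans ?_⟩
  rw [_root_.smul_apply, NNReal.smul_def, smul_eq_mul]
  refine mul_le_mul_of_nonneg_left ?_ C.2
  refine Seminorm.le_def.1 (Finset.sup_mono fun i hi => Finset.mem_Iic.2 ?_) g
  have := Finset.le_sup (f := fun i : ℕ × ℕ => max i.1 i.2) hi
  exact ⟨(le_max_left _ _).trans this, (le_max_right _ _).trans this⟩

theorem exists_bound_of_clm (S : 𝓢(V, ℂ) →L[ℂ] ℂ) :
    ∃ (M : ℕ) (C : ℝ), 0 ≤ C ∧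
      ∀ g, ‖S g‖ ≤ C * (Finset.Iic (M, M)).sup (schwartzSeminormFamily ℂ V ℂ) g :=
  exists_bound_of_continuous_seminorm (q := (normSeminorm ℂ ℂ).comp S.toLinearMap)
    (continuous_norm.comp S.continuous)

theorem lineDerivOp_comm (v w : V) (f : 𝓢(V, ℂ)) :
    ∂_{v} (∂_{w} f : 𝓢(V, ℂ)) = (∂_{w} (∂_{v} f : 𝓢(V, ℂ)) : 𝓢(V, ℂ)) := by
  have key : ∀ (a b : V) (x : V), (∂_{a} (∂_{b} f : 𝓢(V, ℂ)) : 𝓢(V, ℂ)) x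
      = fderiv ℝ (fderiv ℝ f) x a b := by
    intro a b x
    rw [lineDerivOp_apply_eq_fderiv]
    have h : (⇑(∂_{b} f : 𝓢(V, ℂ)) : V → ℂ) = fun y => fderiv ℝ f y b := rfl
    have hd : DifferentiableAt ℝ (fderiv ℝ f) x :=
      ((f.smooth ⊤).fderiv_right (m := 1) (by norm_cast)).differentiable (by norm_num) x
    rw [h, fderiv_clm_apply hd (differentiableAt_const b)]
    simp
  ext x
  rw [key, key]
  refine ((f.smooth ⊤).contDiffAt.isSymmSndFDerivAt ?_) v w
  rw [minSmoothness_of_isRCLikeNormedField]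
  exact WithTop.coe_le_coe.2 le_top

theorem iteratedLineDerivOp_lineDerivOp_comm {l : ℕ} (m : Fin l → V) (v : V) (f : 𝓢(V, ℂ)) :
    ∂^{m} (∂_{v} f : 𝓢(V, ℂ)) = (∂_{v} (∂^{m} f : 𝓢(V, ℂ)) : 𝓢(V, ℂ)) := by
  induction l with
  | zero => rfl
  | succ l ih =>
    rw [LineDeriv.iteratedLineDerivOp_succ_left, LineDeriv.iteratedLineDerivOp_succ_left, ih,
      lineDerivOp_comm]

/-- Directional derivatives commute. This identifies `D^l (∂_h g)` with the linear Taylor term of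
`D^l g`. -/
theorem iteratedFDeriv_lineDerivOp (l : ℕ) (v : V) (f : 𝓢(V, ℂ)) (y : V) :
    iteratedFDeriv ℝ l (∂_{v} f : 𝓢(V, ℂ)) y = fderiv ℝ (iteratedFDeriv ℝ l f) y v := by
  ext m
  have hd : DifferentiableAt ℝ (iteratedFDeriv ℝ l f) y :=
    (f.smooth ⊤).differentiable_iteratedFDeriv (mod_cast ENat.natCast_lt_top l) y
  rw [← iteratedLineDerivOp_eq_iteratedFDeriv, iteratedLineDerivOp_lineDerivOp_comm,
    lineDerivOp_apply_eq_fderiv, ← fderiv_continuousMultilinear_apply_const_apply hd]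
  congr 2
  ext z
  exact iteratedLineDerivOp_eq_iteratedFDeriv

/-- A weighted bound for the derivatives of `g` that is stable under small shifts. -/
theorem exists_pow_mul_norm_iteratedFDeriv_le (k l : ℕ) (g : 𝓢(V, ℂ)) :
    ∃ A, 0 ≤ A ∧ ∀ y z, ‖z - y‖ ≤ 1 → ‖y‖ ^ k * ‖iteratedFDeriv ℝ l g z‖ ≤ A := by
  -- Since `‖y‖ ≤ 1 + ‖z‖`, the weight moves from `y` to `z`; the factor `2 ^ k` comes from
  -- `one_add_le_sup_seminorm_apply`.
  refine ⟨2 ^ k * (Finset.Iic (k, l)).sup (fun m => SchwartzMap.seminorm ℂ m.1 m.2) g,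
    by positivity, fun y z h => ?_⟩
  refine le_trans ?_ (one_add_le_sup_seminorm_apply (𝕜 := ℂ) (m := (k, l)) le_rfl le_rfl g z)
  gcongr
  have := norm_sub_norm_le y z
  rw [norm_sub_rev] at this
  linarith

theorem exists_seminorm_translate_sub_le (k l : ℕ) (g : 𝓢(V, ℂ)) :
    ∃ C, 0 ≤ C ∧ ∀ h : V, ‖h‖ ≤ 1 →
      SchwartzMap.seminorm ℂ k l (g.compSubConstCLM ℂ h - g) ≤ C * ‖h‖ := by
  obtain ⟨A, hA, H⟩ := exists_pow_mul_norm_iteratedFDeriv_le k (l + 1) g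
  refine ⟨A, hA, fun h hh => seminorm_le_bound _ _ _ _ (by positivity) fun y => ?_⟩
  have e : iteratedFDeriv ℝ l (g.compSubConstCLM ℂ h - g : 𝓢(V, ℂ)) y
      = iteratedFDeriv ℝ l g (y - h) - iteratedFDeriv ℝ l g y := by
    have : (⇑(g.compSubConstCLM ℂ h - g : 𝓢(V, ℂ)) : V → ℂ) = (fun z => g (z - h)) - g := rfl
    have h1 : ContDiffAt ℝ l (fun z => g (z - h)) y := (g.compSubConstCLM ℂ h).contDiffAt l
    rw [this, iteratedFDeriv_sub_apply h1 (g.contDiffAt l), iteratedFDeriv_comp_sub]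
  rw [e]
  have hd : ∀ z, DifferentiableAt ℝ (iteratedFDeriv ℝ l g) z := fun z =>
    (g.smooth ⊤).differentiable_iteratedFDeriv (mod_cast ENat.natCast_lt_top l) z
  have hd' : ∀ z, DifferentiableAt ℝ (fun z => (‖y‖ ^ k) • iteratedFDeriv ℝ l g z) z :=
    fun z => (hd z).const_smul (‖y‖ ^ k)
  -- Mean value inequality with the weight `‖y‖ ^ k` frozen at the centre, so that it is a mere
  -- constant.
  have := Convex.norm_image_sub_le_of_norm_fderiv_le (𝕜 := ℝ)
    (f := fun z => (‖y‖ ^ k) • iteratedFDeriv ℝ l g z) (C := A) (s := Metric.closedBall y 1)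
    (x := y) (y := y - h) (fun z _ => hd' z)
    (fun z hz => by
      rw [fderiv_fun_const_smul (hd z), norm_smul, norm_fderiv_iteratedFDeriv]
      simpa using H y z (by simpa [dist_eq_norm] using hz))
    (convex_closedBall _ _) (by simp) (by simpa [dist_eq_norm] using hh)
  rw [← smul_sub, norm_smul] at this
  simpa using this

/-- Second-order Taylor remainder by two mean value inequalities. The sign is a plus because the
translate is `g(· - h)`, whose linear term is `-∂_h g`. -/
theorem exists_seminorm_translate_sub_add_lineDerivOp_le (k l : ℕ) (g : 𝓢(V, ℂ)) :
    ∃ C, 0 ≤ C ∧ ∀ h : V, ‖h‖ ≤ 1 →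
      SchwartzMap.seminorm ℂ k l (g.compSubConstCLM ℂ h - g + ∂_{h} g) ≤ C * ‖h‖ ^ 2 := by
  obtain ⟨A, hA, H⟩ := exists_pow_mul_norm_iteratedFDeriv_le k (l + 2) g
  refine ⟨A, hA, fun h hh => seminorm_le_bound _ _ _ _ (by positivity) fun y => ?_⟩
  have e : iteratedFDeriv ℝ l (g.compSubConstCLM ℂ h - g + ∂_{h} g : 𝓢(V, ℂ)) y
      = iteratedFDeriv ℝ l g (y - h) - iteratedFDeriv ℝ l g y
        - fderiv ℝ (iteratedFDeriv ℝ l g) y (y - h - y) := by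
    have : (⇑(g.compSubConstCLM ℂ h - g + ∂_{h} g : 𝓢(V, ℂ)) : V → ℂ)
      = ((fun z => g (z - h)) - g) + (∂_{h} g : 𝓢(V, ℂ)) := rfl
    have h1 : ContDiffAt ℝ l (fun z => g (z - h)) y := (g.compSubConstCLM ℂ h).contDiffAt l
    have h2 : ContDiffAt ℝ l ((fun z => g (z - h)) - ⇑g) y := h1.sub (g.contDiffAt l)
    rw [this, iteratedFDeriv_add_apply h2 ((∂_{h} g : 𝓢(V, ℂ)).contDiffAt l),
      iteratedFDeriv_sub_apply h1 (g.contDiffAt l), iteratedFDeriv_comp_sub,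
      iteratedFDeriv_lineDerivOp]
    have : y - h - y = -h := by abel
    rw [this, map_neg, sub_neg_eq_add]
  rw [e]
  have hd : ∀ j z, DifferentiableAt ℝ (iteratedFDeriv ℝ j g) z := fun j z =>
    (g.smooth ⊤).differentiable_iteratedFDeriv (mod_cast ENat.natCast_lt_top j) z
  have hsub : ∀ z, z ∈ Metric.closedBall y ‖h‖ → ‖z - y‖ ≤ ‖h‖ := fun z hz => by
    simpa [dist_eq_norm] using hz
  -- Working on the ball of radius `‖h‖` instead of `1` yields the first factor `‖h‖`; the second
  -- comes from the increment `-h` below.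
  have step1 : ∀ z ∈ Metric.closedBall y ‖h‖,
      ‖y‖ ^ k * ‖fderiv ℝ (iteratedFDeriv ℝ l g) z - fderiv ℝ (iteratedFDeriv ℝ l g) y‖
        ≤ A * ‖h‖ := by
    intro z hz
    have hiso : ‖fderiv ℝ (iteratedFDeriv ℝ l g) z - fderiv ℝ (iteratedFDeriv ℝ l g) y‖
        = ‖iteratedFDeriv ℝ (l + 1) g z - iteratedFDeriv ℝ (l + 1) g y‖ := by
      rw [iteratedFDeriv_succ_eq_comp_left, Function.comp_apply, Function.comp_apply,
        ← dist_eq_norm, LinearIsometryEquiv.dist_map]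
      exact (dist_eq_norm (fderiv ℝ (iteratedFDeriv ℝ l g) z)
        (fderiv ℝ (iteratedFDeriv ℝ l g) y)).symm
    rw [hiso]
    have hd' : ∀ z, DifferentiableAt ℝ (fun z => (‖y‖ ^ k) • iteratedFDeriv ℝ (l + 1) g z) z :=
      fun z => (hd _ z).const_smul (‖y‖ ^ k)
    have := Convex.norm_image_sub_le_of_norm_fderiv_le (𝕜 := ℝ)
      (f := fun z => (‖y‖ ^ k) • iteratedFDeriv ℝ (l + 1) g z) (C := A)
      (s := Metric.closedBall y ‖h‖) (x := y) (y := z) (fun z _ => hd' z)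
      (fun z hz => by
        rw [fderiv_fun_const_smul (hd _ z), norm_smul, norm_fderiv_iteratedFDeriv]
        simpa using H y z ((hsub z hz).trans hh))
      (convex_closedBall _ _) (by simp) hz
    rw [← smul_sub, norm_smul] at this
    refine (by simpa using this : _ ≤ A * ‖z - y‖).trans ?_
    gcongr
    exact hsub z hz
  have hd' : ∀ z, DifferentiableAt ℝ (fun z => (‖y‖ ^ k) • iteratedFDeriv ℝ l g z) z :=
    fun z => (hd _ z).const_smul (‖y‖ ^ k)
  have := Convex.norm_image_sub_le_of_norm_fderiv_le' (𝕜 := ℝ)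
    (f := fun z => (‖y‖ ^ k) • iteratedFDeriv ℝ l g z) (C := A * ‖h‖)
    (φ := (‖y‖ ^ k) • fderiv ℝ (iteratedFDeriv ℝ l g) y)
    (s := Metric.closedBall y ‖h‖) (x := y) (y := y - h) (fun z _ => hd' z)
    (fun z hz => by
      rw [fderiv_fun_const_smul (hd _ z), ← smul_sub, norm_smul]
      simpa using step1 z hz)
    (convex_closedBall _ _) (by simp) (by simp)
  rw [_root_.smul_apply, ← smul_sub, ← smul_sub, norm_smul] at this
  refine (by simpa using this : _ ≤ A * ‖h‖ * ‖h‖).trans (le_of_eq (by ring)) |>.trans' ?_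
  simp

theorem continuous_translate (g : 𝓢(V, ℂ)) :
    Continuous fun x : V => g.compSubConstCLM ℂ x := by
  rw [continuous_iff_continuousAt]
  intro x
  rw [ContinuousAt, (schwartz_withSeminorms ℂ V ℂ).tendsto_nhds]
  rintro ⟨k, l⟩ ε hε
  obtain ⟨C, hC, H⟩ := exists_seminorm_translate_sub_le k l (g.compSubConstCLM ℂ x)
  have h1 : Tendsto (fun y : V => C * ‖y - x‖) (𝓝 x) (𝓝 0) := by
    have : Continuous fun y : V => C * ‖y - x‖ := by fun_prop
    simpa using this.tendsto x
  have h2 : Tendsto (fun y : V => ‖y - x‖) (𝓝 x) (𝓝 0) := by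
    have : Continuous fun y : V => ‖y - x‖ := by fun_prop
    simpa using this.tendsto x
  filter_upwards [h1.eventually_lt_const hε, h2.eventually_lt_const one_pos] with y hy1 hy2
  refine lt_of_le_of_lt ?_ hy1
  have := H (y - x) hy2.le
  rwa [compSubConstCLM_comp, add_sub_cancel] at this

end Seminorm

end SchwartzMap

namespace Colombeau

instance zeroFilter_neBot : zeroFilter.NeBot := by
  rw [zeroFilter, comap_neBot_iff_frequently]
  have : (0 : ℝ) ∈ closure (Ioc (0 : ℝ) 1) := by
    rw [closure_Ioc (by norm_num)]
    exact ⟨le_rfl, zero_le_one⟩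
  refine (mem_closure_iff_frequently.1 this).mono fun x hx => ⟨⟨x, hx⟩, rfl⟩

theorem tendsto_zeroFilter : Tendsto (fun ε : Ioc (0 : ℝ) 1 => (ε : ℝ)) zeroFilter (𝓝 0) :=
  tendsto_comap

end Colombeau

namespace SchwartzMap

variable {V : Type*} [NormedAddCommGroup V]

/-! ### Multiplication by `ψ(ε·)` tends to the identity on Schwartz space -/

section Dilate

variable [NormedSpace ℝ V]

/-- For `i ≥ 1` the chain rule gives `ε^i ≤ ε`; for `i = 0` the mean value inequality gives `ε` at
the price of linear growth in `x`. -/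
theorem exists_norm_iteratedFDeriv_dilate_sub_one_le (ψ : 𝓢(V, ℂ)) (hψ : ψ 0 = 1) (l : ℕ) :
    ∃ A, 0 ≤ A ∧ ∀ i ≤ l, ∀ (ε : ℝ), |ε| ≤ 1 → ∀ x : V,
      ‖iteratedFDeriv ℝ i (fun y => ψ (ε • y) - 1) x‖ ≤ A * |ε| * (1 + ‖x‖) := by
  -- The range is `l + 2` so that the order-one seminorm, needed for `i = 0`, is present even when
  -- `l = 0`.
  refine ⟨∑ i ∈ Finset.range (l + 2), SchwartzMap.seminorm ℂ 0 i ψ,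
    Finset.sum_nonneg fun _ _ => by positivity, fun i hi ε hε x => ?_⟩
  have hle : ∀ j < l + 2, SchwartzMap.seminorm ℂ 0 j ψ ≤
      ∑ i ∈ Finset.range (l + 2), SchwartzMap.seminorm ℂ 0 i ψ := fun j hj =>
    Finset.single_le_sum (f := fun i => SchwartzMap.seminorm ℂ 0 i ψ)
      (fun _ _ => by positivity) (Finset.mem_range.2 hj)
  have hA : 0 ≤ ∑ i ∈ Finset.range (l + 2), SchwartzMap.seminorm ℂ 0 i ψ :=
    Finset.sum_nonneg fun _ _ => by positivity
  rcases Nat.eq_zero_or_pos i with rfl | hi0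
  · rw [norm_iteratedFDeriv_zero, ← hψ]
    have := Convex.norm_image_sub_le_of_norm_fderiv_le (𝕜 := ℝ) (f := ψ)
      (C := SchwartzMap.seminorm ℂ 0 1 ψ) (s := univ) (x := 0) (y := ε • x)
      (fun z _ => ψ.differentiableAt)
      (fun z _ => by
        rw [← norm_iteratedFDeriv_one]
        exact norm_iteratedFDeriv_le_seminorm ℂ ψ 1 z)
      convex_univ (mem_univ _) (mem_univ _)
    refine this.trans ?_
    rw [sub_zero, norm_smul, Real.norm_eq_abs, ← mul_assoc]
    gcongr
    · exact hle 1 (by omega)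
    · linarith
  · have h1 : ContDiff ℝ i (fun y => ψ (ε • y)) := (ψ.smooth i).comp (contDiff_const_smul ε)
    have h2 : iteratedFDeriv ℝ i (fun y => ψ (ε • y) - 1) x
        = iteratedFDeriv ℝ i (fun y => ψ (ε • y)) x := by
      have e : (fun y => ψ (ε • y) - 1) = (fun y => ψ (ε • y)) - fun _ => (1 : ℂ) := rfl
      rw [e, iteratedFDeriv_sub_apply h1.contDiffAt contDiffAt_const,
        iteratedFDeriv_const_of_ne hi0.ne', Pi.zero_apply, sub_zero]
    rw [h2, iteratedFDeriv_comp_const_smul ε (ψ.smooth i), norm_smul, norm_pow, Real.norm_eq_abs]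
    have h3 : |ε| ^ i ≤ |ε| := pow_le_of_le_one (abs_nonneg _) hε hi0.ne'
    have h4 := (norm_iteratedFDeriv_le_seminorm ℂ ψ i (ε • x)).trans (hle i (by omega))
    calc |ε| ^ i * ‖iteratedFDeriv ℝ i ψ (ε • x)‖
        ≤ |ε| * ∑ i ∈ Finset.range (l + 2), SchwartzMap.seminorm ℂ 0 i ψ := by gcongr
      _ = (∑ i ∈ Finset.range (l + 2), SchwartzMap.seminorm ℂ 0 i ψ) * |ε| * 1 := by ring
      _ ≤ _ := by
        gcongr
        linarith [norm_nonneg x]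

/-- Leibniz rule: the decay of `g` with weight `k + 1` absorbs the linear growth of `ψ(ε·) - 1`, and
the binomial coefficients sum to `2 ^ l`. -/
theorem exists_seminorm_dilate_mul_sub_le (ψ g : 𝓢(V, ℂ)) (hψ : ψ 0 = 1) (k l : ℕ) :
    ∃ C, ∀ (ε : ℝ), |ε| ≤ 1 → ∀ h : 𝓢(V, ℂ), (∀ x, h x = ψ (ε • x) * g x) →
      SchwartzMap.seminorm ℂ k l (h - g) ≤ C * |ε| := by
  obtain ⟨A, hA, H⟩ := exists_norm_iteratedFDeriv_dilate_sub_one_le ψ hψ l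
  set B := 2 ^ (k + 1) * (Finset.Iic (k + 1, l)).sup (fun m => SchwartzMap.seminorm ℂ m.1 m.2) g
    with hB
  have hB0 : 0 ≤ B := by positivity
  refine ⟨2 ^ l * (A * B), fun ε hε h hh => seminorm_le_bound _ _ _ _ (by positivity) fun x => ?_⟩
  have e : (⇑(h - g) : V → ℂ) = fun y => (ψ (ε • y) - 1) * g y := by
    ext y
    simp [hh y, sub_mul]
  have h1 : ContDiff ℝ l (fun y => ψ (ε • y) - 1) :=
    ((ψ.smooth l).comp (contDiff_const_smul ε)).sub contDiff_const
  rw [e]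
  calc ‖x‖ ^ k * ‖iteratedFDeriv ℝ l (fun y => (ψ (ε • y) - 1) * g y) x‖
      ≤ ‖x‖ ^ k * ∑ i ∈ Finset.range (l + 1), (l.choose i : ℝ) *
        ‖iteratedFDeriv ℝ i (fun y => ψ (ε • y) - 1) x‖ * ‖iteratedFDeriv ℝ (l - i) g x‖ := by
        gcongr
        exact norm_iteratedFDeriv_mul_le h1 (g.smooth l) x le_rfl
    _ = ∑ i ∈ Finset.range (l + 1), (l.choose i : ℝ) * (‖x‖ ^ k *
        (‖iteratedFDeriv ℝ i (fun y => ψ (ε • y) - 1) x‖ * ‖iteratedFDeriv ℝ (l - i) g x‖)) := by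
        rw [Finset.mul_sum]
        exact Finset.sum_congr rfl fun _ _ => by ring
    _ ≤ ∑ i ∈ Finset.range (l + 1), (l.choose i : ℝ) * (A * B * |ε|) := by
        refine Finset.sum_le_sum fun i hi => ?_
        have hi' : i ≤ l := Nat.lt_succ_iff.1 (Finset.mem_range.1 hi)
        refine mul_le_mul_of_nonneg_left ?_ (Nat.cast_nonneg _)
        calc ‖x‖ ^ k * (‖iteratedFDeriv ℝ i (fun y => ψ (ε • y) - 1) x‖
              * ‖iteratedFDeriv ℝ (l - i) g x‖)
            ≤ (1 + ‖x‖) ^ k * (A * |ε| * (1 + ‖x‖) * ‖iteratedFDeriv ℝ (l - i) g x‖) := by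
              gcongr
              · linarith
              · exact H i hi' ε hε x
          _ = A * |ε| * ((1 + ‖x‖) ^ (k + 1) * ‖iteratedFDeriv ℝ (l - i) g x‖) := by ring
          _ ≤ A * |ε| * B := by
              gcongr
              exact one_add_le_sup_seminorm_apply (𝕜 := ℂ) (m := (k + 1, l)) le_rfl
                (Nat.sub_le _ _) g x
          _ = A * B * |ε| := by ring
    _ = 2 ^ l * (A * B) * |ε| := by
        rw [← Finset.sum_mul, ← Nat.cast_sum, Nat.sum_range_choose]
        push_cast
        ring

/-- Serves twice: on the Fourier side for the mollifiers, and with a bump function for the density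
of compactly supported functions. -/
theorem tendsto_dilate_mul (ψ g : 𝓢(V, ℂ)) (hψ : ψ 0 = 1) (h : Ioc (0 : ℝ) 1 → 𝓢(V, ℂ))
    (hh : ∀ ε x, h ε x = ψ ((ε : ℝ) • x) * g x) : Tendsto h zeroFilter (𝓝 g) := by
  rw [(schwartz_withSeminorms ℂ V ℂ).tendsto_nhds]
  rintro ⟨k, l⟩ δ hδ
  obtain ⟨C, hC⟩ := exists_seminorm_dilate_mul_sub_le ψ g hψ k l
  have h1 : Tendsto (fun ε : Ioc (0 : ℝ) 1 => C * (ε : ℝ)) zeroFilter (𝓝 0) := by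
    simpa using tendsto_zeroFilter.const_mul C
  filter_upwards [h1.eventually_lt_const hδ] with ε hε
  have habs : |(ε : ℝ)| = ε := abs_of_pos ε.2.1
  refine lt_of_le_of_lt ?_ hε
  rw [← habs]
  exact hC ε (habs.le.trans ε.2.2) (h ε) (hh ε)

end Dilate

/-! ### Tempered distributions factor through a Banach space -/

section Embedding

variable [NormedSpace ℝ V]

/-- The weighted derivatives `‖y‖ ^ k • D^l g y`, `k, l ≤ M`, as bounded continuous functions. -/
def WeightedJets (V : Type*) [NormedAddCommGroup V] [NormedSpace ℝ V] (M : ℕ) : Type _ :=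
  (i : Finset.Iic (M, M)) → BoundedContinuousFunction V (V [×i.1.2]→L[ℝ] ℂ)

noncomputable instance (M : ℕ) : NormedAddCommGroup (WeightedJets V M) :=
  inferInstanceAs (NormedAddCommGroup
    ((i : Finset.Iic (M, M)) → BoundedContinuousFunction V (V [×i.1.2]→L[ℝ] ℂ)))

noncomputable instance (M : ℕ) : NormedSpace ℂ (WeightedJets V M) :=
  inferInstanceAs (NormedSpace ℂ
    ((i : Finset.Iic (M, M)) → BoundedContinuousFunction V (V [×i.1.2]→L[ℝ] ℂ)))

instance (M : ℕ) : CompleteSpace (WeightedJets V M) :=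
  inferInstanceAs (CompleteSpace
    ((i : Finset.Iic (M, M)) → BoundedContinuousFunction V (V [×i.1.2]→L[ℝ] ℂ)))

/-- Evaluation of a component of a family of jets at a point and at a tuple of vectors. -/
noncomputable def WeightedJets.evalCLM {M : ℕ} (i : Finset.Iic (M, M)) (y : V)
    (m : Fin i.1.2 → V) : WeightedJets V M →L[ℂ] ℂ :=
  LinearMap.mkContinuous
    { toFun := fun b => b i y m
      map_add' := fun _ _ => rfl
      map_smul' := fun _ _ => rfl } (∏ j, ‖m j‖) fun b => by
        refine ((b i y).le_opNorm m).trans ?_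
        rw [mul_comm]
        refine mul_le_mul_of_nonneg_left ?_ (Finset.prod_nonneg fun _ _ => norm_nonneg _)
        exact ((b i).norm_coe_le_norm y).trans (norm_le_pi_norm
          (G := fun i : Finset.Iic (M, M) => BoundedContinuousFunction V (V [×i.1.2]→L[ℝ] ℂ)) b i)

theorem WeightedJets.ext_eval {M : ℕ} {b c : WeightedJets V M}
    (h : ∀ i y m, evalCLM i y m b = evalCLM i y m c) : b = c := by
  funext i
  refine BoundedContinuousFunction.ext fun y => ContinuousMultilinearMap.ext fun m => h i y m

/-- The weighted derivative `‖y‖ ^ k • D^l g y` as a bounded continuous function. -/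
noncomputable def weightedJet (k l : ℕ) (g : 𝓢(V, ℂ)) :
    BoundedContinuousFunction V (V [×l]→L[ℝ] ℂ) :=
  BoundedContinuousFunction.ofNormedAddCommGroup
    (fun y => (‖y‖ ^ k) • iteratedFDeriv ℝ l g y)
    ((continuous_norm.pow _).smul ((g.smooth l).continuous_iteratedFDeriv le_rfl))
    (SchwartzMap.seminorm ℂ k l g) fun y => by
      rw [norm_smul, norm_pow, norm_norm]
      exact le_seminorm ℂ _ _ g y

theorem weightedJet_apply (k l : ℕ) (g : 𝓢(V, ℂ)) (y : V) (m : Fin l → V) :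
    weightedJet k l g y m = (‖y‖ ^ k : ℝ) • (∂^{m} g : 𝓢(V, ℂ)) y := by
  rw [iteratedLineDerivOp_eq_iteratedFDeriv]
  rfl

theorem norm_weightedJet (k l : ℕ) (g : 𝓢(V, ℂ)) :
    ‖weightedJet k l g‖ = SchwartzMap.seminorm ℂ k l g := by
  refine le_antisymm
    (BoundedContinuousFunction.norm_ofNormedAddCommGroup_le _ (apply_nonneg _ _) _) ?_
  refine seminorm_le_bound ℂ _ _ g (norm_nonneg (weightedJet k l g)) fun y => ?_
  refine le_trans (le_of_eq ?_) ((weightedJet k l g).norm_coe_le_norm y)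
  change _ = ‖(‖y‖ ^ k) • iteratedFDeriv ℝ l g y‖
  rw [norm_smul, norm_pow, norm_norm]

/-- The map from a Schwartz function to its weighted jets, without its topology. -/
noncomputable def weightedJetsLM (M : ℕ) : 𝓢(V, ℂ) →ₗ[ℂ] WeightedJets V M where
  toFun g i := weightedJet i.1.1 i.1.2 g
  map_add' f g := by
    refine WeightedJets.ext_eval fun i y m => ?_
    change weightedJet _ _ _ y m = weightedJet _ _ _ y m + weightedJet _ _ _ y m
    rw [weightedJet_apply, weightedJet_apply, weightedJet_apply,
      LineDeriv.iteratedLineDerivOp_add, ← smul_add]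
    rfl
  map_smul' c f := by
    refine WeightedJets.ext_eval fun i y m => ?_
    change weightedJet _ _ _ y m = c • weightedJet _ _ _ y m
    rw [weightedJet_apply, weightedJet_apply, LineDeriv.iteratedLineDerivOp_smul, smul_comm]
    rfl

/-- This turns a Schwartz seminorm bound on a functional into domination by a Banach norm, ready for
Hahn–Banach. -/
theorem norm_weightedJetsLM (M : ℕ) (g : 𝓢(V, ℂ)) :
    ‖weightedJetsLM M g‖ = (Finset.Iic (M, M)).sup (schwartzSeminormFamily ℂ V ℂ) g := by
  refine le_antisymm ((pi_norm_le_iff_of_nonneg (apply_nonneg _ _)).2 fun i => ?_)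
    (Seminorm.finset_sup_apply_le (norm_nonneg _) fun i hi => ?_)
  · exact (norm_weightedJet _ _ g).le.trans
      (Seminorm.le_def.1 (Finset.le_sup (f := schwartzSeminormFamily ℂ V ℂ) i.2) g)
  · rw [schwartzSeminormFamily_apply, ← norm_weightedJet]
    exact norm_le_pi_norm
      (G := fun i : Finset.Iic (M, M) => BoundedContinuousFunction V (V [×i.1.2]→L[ℝ] ℂ))
      (weightedJetsLM M g) ⟨i, hi⟩

/-- The map from a Schwartz function to its weighted jets. -/
noncomputable def weightedJets (M : ℕ) : 𝓢(V, ℂ) →L[ℂ] WeightedJets V M :=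
  mkCLMtoNormedSpace (weightedJetsLM M) (map_add _) (map_smul _)
    ⟨Finset.Iic (M, M), 1, zero_le_one, fun g => by rw [one_mul, norm_weightedJetsLM]⟩

theorem evalCLM_weightedJets (M : ℕ) (g : 𝓢(V, ℂ)) (i : Finset.Iic (M, M)) (y : V)
    (m : Fin i.1.2 → V) :
    WeightedJets.evalCLM i y m (weightedJets M g) = (‖y‖ ^ i.1.1 : ℝ) • (∂^{m} g : 𝓢(V, ℂ)) y :=
  weightedJet_apply _ _ g y m

theorem weightedJetsLM_injective (M : ℕ) : Function.Injective (weightedJetsLM (V := V) M) := by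
  intro f g h
  ext y
  have h1 : weightedJet 0 0 f = weightedJet 0 0 g :=
    congrFun h (⟨(0, 0), by simp⟩ : Finset.Iic (M, M))
  have := congr(($h1 : V → V [×0]→L[ℝ] ℂ) y default)
  rw [weightedJet_apply, weightedJet_apply] at this
  simpa using this

/-- A linear functional dominated by the norm of `J` factors through `J`. -/
theorem exists_clm_comp_eq_of_norm_le {X B : Type*} [AddCommGroup X] [Module ℂ X]
    [NormedAddCommGroup B] [NormedSpace ℂ B] (J : X →ₗ[ℂ] B) (hJ : Function.Injective J)
    (S : X →ₗ[ℂ] ℂ) (C : ℝ≥0) (h : ∀ x, ‖S x‖ ≤ C * ‖J x‖) :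
    ∃ Λ : B →L[ℂ] ℂ, ∀ x, S x = Λ (J x) := by
  let e := LinearEquiv.ofInjective J hJ
  have key : ∀ x, (S ∘ₗ e.symm.toLinearMap) (e x) = S x := fun x => by simp
  -- Hahn–Banach applied to `S ∘ J⁻¹` on the range of `J`, with the dominating seminorm `C‖·‖`.
  obtain ⟨Λ, h1, h2⟩ := Module.Dual.exists_extension_of_le_seminorm (LinearMap.range J)
    (S ∘ₗ e.symm.toLinearMap) (p := C • normSeminorm ℂ B) (by
      intro x
      obtain ⟨g, rfl⟩ := e.surjective x
      rw [key]
      exact h g)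
  refine ⟨LinearMap.mkContinuous Λ C h2, fun g => ?_⟩
  rw [← key g, ← h1 (e g)]
  rfl

/-- A tempered distribution factors through the Banach space of weighted jets. -/
theorem exists_factor_weightedJets (S : 𝓢(V, ℂ) →L[ℂ] ℂ) :
    ∃ (M : ℕ) (Λ : WeightedJets V M →L[ℂ] ℂ), ∀ g, S g = Λ (weightedJets M g) := by
  obtain ⟨M, C, hC, H⟩ := exists_bound_of_clm S
  lift C to ℝ≥0 using hC
  exact ⟨M, exists_clm_comp_eq_of_norm_le (weightedJetsLM M) (weightedJetsLM_injective M)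
    S.toLinearMap C fun g => (H g).trans_eq (by rw [norm_weightedJetsLM])⟩

end Embedding

end SchwartzMap

namespace SchwartzMap

section Translate

variable {V : Type*} [NormedAddCommGroup V] [NormedSpace ℝ V]

theorem iteratedLineDerivOp_translate {l : ℕ} (m : Fin l → V) (g : 𝓢(V, ℂ)) (x y : V) :
    (∂^{m} (g.compSubConstCLM ℂ x) : 𝓢(V, ℂ)) y = (∂^{m} g : 𝓢(V, ℂ)) (y - x) := by
  rw [iteratedLineDerivOp_eq_iteratedFDeriv, iteratedLineDerivOp_eq_iteratedFDeriv]
  exact congr($(iteratedFDeriv_comp_sub (𝕜 := ℝ) (f := g) l x y) m)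

theorem lineDerivOp_translate (v : V) (g : 𝓢(V, ℂ)) (x : V) :
    (∂_{v} (g.compSubConstCLM ℂ x) : 𝓢(V, ℂ)) = (∂_{v} g : 𝓢(V, ℂ)).compSubConstCLM ℂ x := by
  ext y
  rw [lineDerivOp_apply_eq_fderiv]
  change fderiv ℝ (fun y => g (y - x)) y v = fderiv ℝ g (y - x) v
  rw [fderiv_comp_sub]

end Translate

/-! ### Convolution and exchange of a distribution with an integral -/

section Convolution

variable {V : Type*} [NormedAddCommGroup V] [InnerProductSpace ℝ V] [FiniteDimensional ℝ V]
  [MeasurableSpace V] [BorelSpace V]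

/-- The convolution of two complex valued Schwartz functions. -/
noncomputable abbrev conv (f g : 𝓢(V, ℂ)) : 𝓢(V, ℂ) :=
  convolution (ContinuousLinearMap.mul ℂ ℂ) f g

theorem conv_apply (f g : 𝓢(V, ℂ)) (y : V) : conv f g y = ∫ x, f x * g (y - x) := by
  rw [conv, convolution_apply]
  rfl

theorem fourier_conv (f g : 𝓢(V, ℂ)) (ξ : V) : 𝓕 (conv f g) ξ = 𝓕 f ξ * 𝓕 g ξ := by
  rw [conv, fourier_convolution]
  rfl

/-- After Fourier transform both sides are the same product of multipliers, so no differentiation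
under the integral is needed. -/
theorem lineDerivOp_conv (v : V) (f g : 𝓢(V, ℂ)) : ∂_{v} (conv f g) = conv f (∂_{v} g) := by
  have hinj : Function.Injective (fun h : 𝓢(V, ℂ) => 𝓕 h) := fun a b h => by
    simpa using congrArg (fun h : 𝓢(V, ℂ) => 𝓕⁻ h) h
  have ht : (inner ℝ · v : V → ℝ).HasTemperateGrowth := by fun_prop
  apply hinj
  ext ξ
  simp only [fourier_conv, fourier_lineDerivOp_eq, smul_apply, smulLeftCLM_apply_apply ht,
    smul_eq_mul, Complex.real_smul]
  ring

theorem iteratedLineDerivOp_conv {l : ℕ} (m : Fin l → V) (f g : 𝓢(V, ℂ)) :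
    ∂^{m} (conv f g) = conv f (∂^{m} g) := by
  induction l with
  | zero => rfl
  | succ l ih =>
    rw [LineDeriv.iteratedLineDerivOp_succ_left, LineDeriv.iteratedLineDerivOp_succ_left, ih,
      lineDerivOp_conv]

/-- A tempered distribution may be exchanged with a convolution integral. -/
theorem integral_mul_apply_translate (S : 𝓢(V, ℂ) →L[ℂ] ℂ) (θ g : 𝓢(V, ℂ))
    (hθ : HasCompactSupport θ) :
    ∫ x, θ x * S (g.compSubConstCLM ℂ x) = S (conv θ g) := by
  -- The factorization lets the integral be a Bochner integral in a Banach space, where the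
  -- continuous functional `Λ` passes through it.
  obtain ⟨M, Λ, hΛ⟩ := exists_factor_weightedJets S
  set F : V → WeightedJets V M := fun x => θ x • weightedJets M (g.compSubConstCLM ℂ x) with hF
  have hcont : Continuous F :=
    θ.continuous.smul ((weightedJets M).continuous.comp (continuous_translate g))
  have hint : Integrable F := hcont.integrable_of_hasCompactSupport hθ.smul_right
  -- Evaluations of jets are continuous and separate points, so the vector-valued identity reduces
  -- to the scalar convolution formula for each derivative.
  have hconv : weightedJets M (conv θ g) = ∫ x, F x := by
    refine WeightedJets.ext_eval fun i y m => ?_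
    rw [← ContinuousLinearMap.integral_comp_comm _ hint, evalCLM_weightedJets,
      iteratedLineDerivOp_conv, conv_apply, ← integral_smul]
    refine integral_congr_ae (Eventually.of_forall fun x => ?_)
    simp only [hF, map_smul, evalCLM_weightedJets, iteratedLineDerivOp_translate, smul_eq_mul,
      Complex.real_smul]
    ring
  rw [hΛ, hconv, ← ContinuousLinearMap.integral_comp_comm _ hint]
  refine integral_congr_ae (Eventually.of_forall fun x => ?_)
  simp only [hF, map_smul, smul_eq_mul, hΛ]

end Convolution

/-! ### Smoothness of `x ↦ S(g(· - x))` -/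

section TranslateDeriv

variable {V : Type*} [NormedAddCommGroup V] [NormedSpace ℝ V]

theorem norm_le_of_seminorm_le (S : 𝓢(V, ℂ) →L[ℂ] ℂ) (u : V → 𝓢(V, ℂ)) (N : V → ℝ)
    (hN : ∀ h, 0 ≤ N h)
    (H : ∀ k l, ∃ C, 0 ≤ C ∧ ∀ h, ‖h‖ ≤ 1 → SchwartzMap.seminorm ℂ k l (u h) ≤ C * N h) :
    ∃ C, ∀ h, ‖h‖ ≤ 1 → ‖S (u h)‖ ≤ C * N h := by
  obtain ⟨M, C, hC, hS⟩ := exists_bound_of_clm S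
  choose D hD0 hD using H
  refine ⟨C * ∑ i ∈ Finset.Iic (M, M), D i.1 i.2, fun h hh => (hS _).trans ?_⟩
  rw [mul_assoc]
  refine mul_le_mul_of_nonneg_left ?_ hC
  have h0 : 0 ≤ ∑ i ∈ Finset.Iic (M, M), D i.1 i.2 := Finset.sum_nonneg fun _ _ => hD0 _ _
  refine Seminorm.finset_sup_apply_le (mul_nonneg h0 (hN h)) fun i hi => ?_
  refine (hD i.1 i.2 h hh).trans (mul_le_mul_of_nonneg_right ?_ (hN h))
  exact Finset.single_le_sum (f := fun i : ℕ × ℕ => D i.1 i.2) (fun _ _ => hD0 _ _) hi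

variable [FiniteDimensional ℝ V]

/-- The derivative at `x` of `x ↦ S (g (· - x))`. -/
noncomputable def translateFDeriv (S : 𝓢(V, ℂ) →L[ℂ] ℂ) (g : 𝓢(V, ℂ)) (x : V) : V →L[ℝ] ℂ :=
  LinearMap.toContinuousLinearMap
    { toFun := fun v => -S ((∂_{v} g : 𝓢(V, ℂ)).compSubConstCLM ℂ x)
      map_add' := fun v w => by
        rw [LineDeriv.lineDerivOp_left_add, map_add, map_add, neg_add]
      map_smul' := fun c v => by
        have : (c • (∂_{v} g : 𝓢(V, ℂ))) = (c : ℂ) • (∂_{v} g : 𝓢(V, ℂ)) := by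
          ext y
          simp
        rw [LineDeriv.lineDerivOp_left_smul, this, map_smul, map_smul]
        simp }

theorem translateFDeriv_apply (S : 𝓢(V, ℂ) →L[ℂ] ℂ) (g : 𝓢(V, ℂ)) (x v : V) :
    translateFDeriv S g x v = -S ((∂_{v} g : 𝓢(V, ℂ)).compSubConstCLM ℂ x) := rfl

/-- The second-order translation estimate, applied to `g(· - x)` and pushed through `S`, makes the
remainder `O(‖h‖²)`. -/
theorem hasFDerivAt_translate (S : 𝓢(V, ℂ) →L[ℂ] ℂ) (g : 𝓢(V, ℂ)) (x : V) :
    HasFDerivAt (fun x => S (g.compSubConstCLM ℂ x)) (translateFDeriv S g x) x := by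
  set f := g.compSubConstCLM ℂ x with hf
  obtain ⟨C, hC⟩ := norm_le_of_seminorm_le S
    (fun h => f.compSubConstCLM ℂ h - f + ∂_{h} f) (fun h => ‖h‖ ^ 2) (fun h => by positivity)
    (fun k l => exists_seminorm_translate_sub_add_lineDerivOp_le k l f)
  rw [hasFDerivAt_iff_isLittleO_nhds_zero]
  have h1 : (fun h => S (g.compSubConstCLM ℂ (x + h)) - S (g.compSubConstCLM ℂ x)
      - translateFDeriv S g x h) =O[𝓝 0] fun h : V => ‖h‖ ^ 2 := by
    refine IsBigO.of_bound C ?_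
    have : ∀ᶠ h : V in 𝓝 0, ‖h‖ < 1 := by
      have : Tendsto (fun h : V => ‖h‖) (𝓝 0) (𝓝 0) := by simpa using tendsto_norm_zero
      exact this.eventually_lt_const one_pos
    filter_upwards [this] with h hh
    rw [Real.norm_of_nonneg (by positivity : 0 ≤ ‖h‖ ^ 2)]
    refine le_trans (le_of_eq ?_) (hC h hh.le)
    rw [translateFDeriv_apply, map_add, map_sub, ← lineDerivOp_translate, ← hf,
      ← compSubConstCLM_comp, sub_neg_eq_add]
  refine h1.trans_isLittleO ?_
  simpa using (isLittleO_norm_pow_id (E' := V) one_lt_two)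

/-- The induction runs over all `g`: a directional derivative is again, up to sign, a function of
this form, with `∂_v g` for `g`. -/
theorem contDiff_translate (S : 𝓢(V, ℂ) →L[ℂ] ℂ) (g : 𝓢(V, ℂ)) (j : ℕ) :
    ContDiff ℝ j (fun x => S (g.compSubConstCLM ℂ x)) := by
  induction j generalizing g with
  | zero =>
    exact contDiff_zero.2
      (continuous_iff_continuousAt.2 fun x => (hasFDerivAt_translate S g x).continuousAt)
  | succ j ih =>
    rw [Nat.cast_add, Nat.cast_one, contDiff_succ_iff_fderiv_apply]
    refine ⟨fun x => (hasFDerivAt_translate S g x).differentiableAt, by simp, fun v => ?_⟩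
    have : (fun x => fderiv ℝ (fun x => S (g.compSubConstCLM ℂ x)) x v)
        = fun x => -S ((∂_{v} g : 𝓢(V, ℂ)).compSubConstCLM ℂ x) := by
      ext x
      rw [(hasFDerivAt_translate S g x).fderiv, translateFDeriv_apply]
    rw [this]
    exact (ih _).neg

theorem iteratedFDeriv_translate (S : 𝓢(V, ℂ) →L[ℂ] ℂ) (g : 𝓢(V, ℂ)) {j : ℕ} (m : Fin j → V)
    (x : V) : iteratedFDeriv ℝ j (fun x => S (g.compSubConstCLM ℂ x)) x m
      = (-1) ^ j * S ((∂^{m} g : 𝓢(V, ℂ)).compSubConstCLM ℂ x) := by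
  induction j generalizing x with
  | zero => simp
  | succ j ih =>
    have hd : DifferentiableAt ℝ (iteratedFDeriv ℝ j (fun x => S (g.compSubConstCLM ℂ x))) x :=
      (contDiff_translate S g (j + 1)).differentiable_iteratedFDeriv (by norm_cast; omega) x
    rw [iteratedFDeriv_succ_apply_left, ← fderiv_continuousMultilinear_apply_const_apply hd]
    have : (fun y => iteratedFDeriv ℝ j (fun x => S (g.compSubConstCLM ℂ x)) y (Fin.tail m))
        = fun y => (-1) ^ j * S ((∂^{Fin.tail m} g : 𝓢(V, ℂ)).compSubConstCLM ℂ y) :=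
      funext fun y => ih (Fin.tail m) y
    rw [this, ((hasFDerivAt_translate S _ x).const_mul _).fderiv, _root_.smul_apply,
      translateFDeriv_apply, LineDeriv.iteratedLineDerivOp_succ_left, smul_eq_mul]
    ring

end TranslateDeriv

end SchwartzMap

namespace SchwartzMap

theorem continuous_sup_seminorm {V : Type*} [NormedAddCommGroup V] [NormedSpace ℝ V] (M : ℕ) :
    Continuous fun g => (Finset.Iic (M, M)).sup (schwartzSeminormFamily ℂ V ℂ) g := by
  simp_rw [← norm_weightedJetsLM]
  exact continuous_norm.comp (weightedJets M).continuous

end SchwartzMap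

/-! ### The mollifiers `φ_ε`: convergence and growth in `ε` -/

namespace Colombeau

variable {n : ℕ}

/-- Brings the convolution at `x` into the form `S(g(· - x))` with the fixed function `g = φ(-·)`.
-/
theorem reflectAt_eq_translate (φ : 𝓢(EuclideanSpace ℝ (Fin n), ℂ))
    (x : EuclideanSpace ℝ (Fin n)) :
    reflectAt φ x = (reflectAt φ 0).compSubConstCLM ℂ x := by
  ext y
  rw [SchwartzMap.compSubConstCLM_apply, reflectAt_apply, reflectAt_apply]
  congr 1
  abel

theorem reflectAt_scaled_apply (φ : 𝓢(EuclideanSpace ℝ (Fin n), ℂ)) (ε : Ioc (0 : ℝ) 1)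
    (y : EuclideanSpace ℝ (Fin n)) :
    reflectAt (scaled φ ε) 0 y
      = ((((ε : ℝ) ^ n)⁻¹ : ℝ) : ℂ) * reflectAt φ 0 ((ε : ℝ)⁻¹ • y) := by
  rw [reflectAt_apply, scaled_apply, reflectAt_apply, zero_sub, zero_sub, smul_neg]

/-- Substitute `v ↦ -v/ε`: the Jacobian cancels the normalization `ε^{-n}`, and the reflection
produces the sign. -/
theorem fourier_reflectAt_scaled (φ : 𝓢(EuclideanSpace ℝ (Fin n), ℂ)) (ε : Ioc (0 : ℝ) 1)
    (ξ : EuclideanSpace ℝ (Fin n)) :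
    𝓕 (reflectAt (scaled φ ε) 0) ξ = 𝓕 φ (-((ε : ℝ) • ξ)) := by
  have hε : (ε : ℝ) ≠ 0 := ε.2.1.ne'
  rw [SchwartzMap.fourier_coe, SchwartzMap.fourier_coe, Real.fourier_eq, Real.fourier_eq]
  have h := Measure.integral_comp_smul (volume : Measure (EuclideanSpace ℝ (Fin n)))
    (fun v => Real.fourierChar (-inner ℝ v (-((ε : ℝ) • ξ))) • φ v) (-(ε : ℝ)⁻¹)
  have hc : |((-(ε : ℝ)⁻¹) ^ Module.finrank ℝ (EuclideanSpace ℝ (Fin n)))⁻¹| = (ε : ℝ) ^ n := by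
    rw [finrank_euclideanSpace_fin, abs_inv, abs_pow, abs_neg, abs_inv, abs_of_pos ε.2.1, inv_pow,
      inv_inv]
  rw [hc] at h
  have h2 : ∫ v, Real.fourierChar (-inner ℝ v (-((ε : ℝ) • ξ))) • φ v
      = (((ε : ℝ) ^ n)⁻¹ : ℝ) • ∫ x, Real.fourierChar
        (-inner ℝ (-(ε : ℝ)⁻¹ • x) (-((ε : ℝ) • ξ))) • φ (-(ε : ℝ)⁻¹ • x) := by
    rw [h, smul_smul, inv_mul_cancel₀ (pow_ne_zero _ hε), one_smul]
  rw [h2, ← integral_smul]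
  refine integral_congr_ae (Eventually.of_forall fun v => ?_)
  have hin : inner ℝ (-(ε : ℝ)⁻¹ • v) (-((ε : ℝ) • ξ)) = inner ℝ v ξ := by
    rw [neg_smul, inner_neg_neg, inner_smul_left, inner_smul_right, conj_trivial, ← mul_assoc,
      inv_mul_cancel₀ hε, one_mul]
  simp only [hin]
  rw [reflectAt_scaled_apply, reflectAt_apply, zero_sub, neg_smul, Circle.smul_def,
    Circle.smul_def, Complex.real_smul, smul_eq_mul, smul_eq_mul]
  ring

theorem tendsto_conv_scaled (ψ θ : 𝓢(EuclideanSpace ℝ (Fin n), ℂ)) (hψ : ψ 0 = 1) :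
    Tendsto (fun ε => SchwartzMap.conv θ (reflectAt (scaled (𝓕⁻ ψ) ε) 0)) zeroFilter (𝓝 θ) := by
  have h1 : Tendsto (fun ε => 𝓕 (SchwartzMap.conv θ (reflectAt (scaled (𝓕⁻ ψ) ε) 0)))
      zeroFilter (𝓝 (𝓕 θ)) := by
    refine SchwartzMap.tendsto_dilate_mul (reflectAt ψ 0) (𝓕 θ)
      (by rw [reflectAt_apply, sub_zero, hψ]) _ fun ε ξ => ?_
    rw [SchwartzMap.fourier_conv, fourier_reflectAt_scaled, FourierTransform.fourier_fourierInv_eq,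
      reflectAt_apply, zero_sub, mul_comm]
  have h2 := ((FourierTransform.fourierInvCLM ℂ
    𝓢(EuclideanSpace ℝ (Fin n), ℂ)).continuous.tendsto _).comp h1
  simpa [Function.comp_def] using h2

/-- The normalization costs `ε^{-n}` and each derivative `ε^{-1}`. The weight costs nothing, as `‖y‖
≤ ‖y/ε‖` for `ε ≤ 1`. -/
theorem seminorm_reflectAt_scaled_le (φ : 𝓢(EuclideanSpace ℝ (Fin n), ℂ)) (k l : ℕ)
    (ε : Ioc (0 : ℝ) 1) :
    SchwartzMap.seminorm ℂ k l (reflectAt (scaled φ ε) 0)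
      ≤ ((ε : ℝ) ^ (n + l))⁻¹ * SchwartzMap.seminorm ℂ k l (reflectAt φ 0) := by
  have hε : 0 < (ε : ℝ) := ε.2.1
  refine SchwartzMap.seminorm_le_bound _ _ _ _ (by positivity) fun y => ?_
  have e : (⇑(reflectAt (scaled φ ε) 0) : EuclideanSpace ℝ (Fin n) → ℂ)
      = (((ε : ℝ) ^ n)⁻¹ : ℝ) • fun y => reflectAt φ 0 ((ε : ℝ)⁻¹ • y) := by
    ext y
    rw [reflectAt_scaled_apply, Pi.smul_apply, Complex.real_smul]
  have h1 : ContDiff ℝ l (fun y => reflectAt φ 0 ((ε : ℝ)⁻¹ • y)) :=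
    ((reflectAt φ 0).smooth l).comp (contDiff_const_smul _)
  rw [e, iteratedFDeriv_const_smul_apply h1.contDiffAt,
    iteratedFDeriv_comp_const_smul _ ((reflectAt φ 0).smooth l), norm_smul, norm_smul,
    Real.norm_of_nonneg (by positivity), Real.norm_of_nonneg (by positivity)]
  have h2 := SchwartzMap.le_seminorm ℂ k l (reflectAt φ 0) ((ε : ℝ)⁻¹ • y)
  have h3 : ‖y‖ ≤ ‖(ε : ℝ)⁻¹ • y‖ := by
    rw [norm_smul, Real.norm_of_nonneg (by positivity)]
    exact le_mul_of_one_le_left (norm_nonneg _) ((one_le_inv₀ hε).2 ε.2.2)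
  calc ‖y‖ ^ k * (((ε : ℝ) ^ n)⁻¹ * ((ε : ℝ)⁻¹ ^ l *
        ‖iteratedFDeriv ℝ l (reflectAt φ 0) ((ε : ℝ)⁻¹ • y)‖))
      ≤ ‖(ε : ℝ)⁻¹ • y‖ ^ k * (((ε : ℝ) ^ n)⁻¹ * ((ε : ℝ)⁻¹ ^ l *
        ‖iteratedFDeriv ℝ l (reflectAt φ 0) ((ε : ℝ)⁻¹ • y)‖)) := by gcongr
    _ = ((ε : ℝ) ^ (n + l))⁻¹ * (‖(ε : ℝ)⁻¹ • y‖ ^ k *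
        ‖iteratedFDeriv ℝ l (reflectAt φ 0) ((ε : ℝ)⁻¹ • y)‖) := by
        rw [pow_add, mul_inv, inv_pow]
        ring
    _ ≤ _ := by gcongr

theorem seminorm_translate_le {V : Type*} [NormedAddCommGroup V] [NormedSpace ℝ V] (M : ℕ)
    {R : ℝ} {x : V} (hx : ‖x‖ ≤ R) (g : 𝓢(V, ℂ)) :
    (Finset.Iic (M, M)).sup (schwartzSeminormFamily ℂ V ℂ) (g.compSubConstCLM ℂ x)
      ≤ (1 + R) ^ M * 2 ^ M * (Finset.Iic (M, M)).sup (schwartzSeminormFamily ℂ V ℂ) g := by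
  have hR : 0 ≤ R := (norm_nonneg x).trans hx
  refine Seminorm.finset_sup_apply_le (by positivity) fun i hi => ?_
  obtain ⟨hk, hl⟩ := Prod.mk_le_mk.1 (Finset.mem_Iic.1 hi)
  refine SchwartzMap.seminorm_le_bound _ _ _ _ (by positivity) fun y => ?_
  have e : iteratedFDeriv ℝ i.2 (g.compSubConstCLM ℂ x) y = iteratedFDeriv ℝ i.2 g (y - x) :=
    iteratedFDeriv_comp_sub (𝕜 := ℝ) (f := g) i.2 x y
  rw [e, mul_assoc]
  have h1 : ‖y‖ ≤ (1 + R) * (1 + ‖y - x‖) := by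
    have : ‖y‖ ≤ ‖y - x‖ + ‖x‖ := norm_le_norm_sub_add y x
    nlinarith [norm_nonneg (y - x)]
  calc ‖y‖ ^ i.1 * ‖iteratedFDeriv ℝ i.2 g (y - x)‖
      ≤ ((1 + R) * (1 + ‖y - x‖)) ^ i.1 * ‖iteratedFDeriv ℝ i.2 g (y - x)‖ := by gcongr
    _ = (1 + R) ^ i.1 * ((1 + ‖y - x‖) ^ i.1 * ‖iteratedFDeriv ℝ i.2 g (y - x)‖) := by
        rw [mul_pow]; ring
    _ ≤ (1 + R) ^ M * (2 ^ M * (Finset.Iic (M, M)).sup (schwartzSeminormFamily ℂ V ℂ) g) := by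
        refine mul_le_mul (pow_le_pow_right₀ (by linarith) hk) ?_ (by positivity) (by positivity)
        exact SchwartzMap.one_add_le_sup_seminorm_apply (𝕜 := ℂ) (m := (M, M)) hk hl g _

theorem exists_moderate_bound (S : 𝓢(EuclideanSpace ℝ (Fin n), ℂ) →L[ℂ] ℂ)
    (φ : 𝓢(EuclideanSpace ℝ (Fin n), ℂ)) {j : ℕ} (m : Fin j → EuclideanSpace ℝ (Fin n)) (R : ℝ) :
    ∃ (C : ℝ) (N : ℕ), 0 ≤ C ∧ ∀ (ε : Ioc (0 : ℝ) 1) (x : EuclideanSpace ℝ (Fin n)), ‖x‖ ≤ R →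
      ‖S ((∂^{m} (reflectAt (scaled φ ε) 0) :
        𝓢(EuclideanSpace ℝ (Fin n), ℂ)).compSubConstCLM ℂ x)‖ ≤ C * ((ε : ℝ) ^ N)⁻¹ := by
  obtain ⟨M, C, hC, hS⟩ := SchwartzMap.exists_bound_of_clm S
  -- The derivative `∂^m` is absorbed into the seminorm, at the cost of passing from `M` to a larger
  -- index `M'`.
  have hq : Continuous (((Finset.Iic (M, M)).sup (schwartzSeminormFamily ℂ
      (EuclideanSpace ℝ (Fin n)) ℂ)).comp (LineDeriv.iteratedLineDerivOpCLM ℂ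
      𝓢(EuclideanSpace ℝ (Fin n), ℂ) m).toLinearMap) := by
    exact (SchwartzMap.continuous_sup_seminorm M).comp (LineDeriv.iteratedLineDerivOpCLM ℂ
      𝓢(EuclideanSpace ℝ (Fin n), ℂ) m).continuous
  obtain ⟨M', C', hC', hS'⟩ := SchwartzMap.exists_bound_of_continuous_seminorm hq
  by_cases hR : 0 ≤ R
  swap
  · exact ⟨0, 0, le_rfl, fun ε x hx => absurd ((norm_nonneg x).trans hx) hR⟩
  set B := (Finset.Iic (M', M')).sup (schwartzSeminormFamily ℂ _ ℂ) (reflectAt φ 0) with hB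
  refine ⟨C * ((1 + R) ^ M * 2 ^ M * (C' * B)), n + M', by positivity, fun ε x hx => ?_⟩
  have hε : 0 < (ε : ℝ) := ε.2.1
  have h1 : (Finset.Iic (M', M')).sup (schwartzSeminormFamily ℂ _ ℂ) (reflectAt (scaled φ ε) 0)
      ≤ ((ε : ℝ) ^ (n + M'))⁻¹ * B := by
    refine Seminorm.finset_sup_apply_le (by positivity) fun i hi => ?_
    obtain ⟨-, hl⟩ := Prod.mk_le_mk.1 (Finset.mem_Iic.1 hi)
    refine (seminorm_reflectAt_scaled_le φ i.1 i.2 ε).trans ?_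
    refine mul_le_mul (inv_anti₀ (by positivity) ?_) ?_ (apply_nonneg _ _) (by positivity)
    · exact pow_le_pow_of_le_one hε.le ε.2.2 (by omega)
    · exact Seminorm.le_def.1 (Finset.le_sup (f := schwartzSeminormFamily ℂ _ ℂ) hi) _
  calc _ ≤ _ := hS _
    _ ≤ C * ((1 + R) ^ M * 2 ^ M * (Finset.Iic (M, M)).sup (schwartzSeminormFamily ℂ _ ℂ)
        (∂^{m} (reflectAt (scaled φ ε) 0))) := by
        gcongr
        exact seminorm_translate_le M hx _
    _ ≤ C * ((1 + R) ^ M * 2 ^ M * (C' * (((ε : ℝ) ^ (n + M'))⁻¹ * B))) := by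
        gcongr
        exact (hS' _).trans (by gcongr)
    _ = _ := by ring

/-! ### Tempered extensions -/

theorem testToSchwartz_apply (θ : 𝓓((⊤ : Opens (EuclideanSpace ℝ (Fin n))), ℝ))
    (x : EuclideanSpace ℝ (Fin n)) : testToSchwartz θ x = θ x := rfl

/-- Bridges the real-valued test functions of `𝓓` and the complex-valued Schwartz functions. -/
theorem exists_eq_testToSchwartz_add (h : 𝓢(EuclideanSpace ℝ (Fin n), ℂ))
    (hh : HasCompactSupport h) : ∃ a b : 𝓓((⊤ : Opens (EuclideanSpace ℝ (Fin n))), ℝ),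
      h = testToSchwartz a + Complex.I • testToSchwartz b := by
  refine ⟨⟨fun x => (h x).re, Complex.reCLM.contDiff.comp (h.smooth ⊤),
    hh.comp_left (g := Complex.re) rfl, fun _ _ => trivial⟩,
    ⟨fun x => (h x).im, Complex.imCLM.contDiff.comp (h.smooth ⊤),
    hh.comp_left (g := Complex.im) rfl, fun _ _ => trivial⟩, ?_⟩
  ext x
  rw [_root_.add_apply, _root_.smul_apply, testToSchwartz_apply, testToSchwartz_apply,
    smul_eq_mul, mul_comm]
  exact (Complex.re_add_im (h x)).symm

/-- Cutting off `g` by a dilated bump `χ(ε·)` gives compactly supported functions that tend to `g`.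
Uniqueness makes `temperedExt`, defined by choice, linear on tempered distributions. -/
theorem IsTemperedExt.unique {T : 𝓓'((⊤ : Opens (EuclideanSpace ℝ (Fin n))), ℂ)}
    {S S' : 𝓢'(EuclideanSpace ℝ (Fin n), ℂ)} (hS : IsTemperedExt T S) (hS' : IsTemperedExt T S') :
    S = S' := by
  have hcpt : ∀ h : 𝓢(EuclideanSpace ℝ (Fin n), ℂ), HasCompactSupport h → S h = S' h := by
    intro h hh
    obtain ⟨a, b, rfl⟩ := exists_eq_testToSchwartz_add h hh
    rw [map_add, map_add, map_smul, map_smul, hS, hS, hS', hS']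
  let b : ContDiffBump (0 : EuclideanSpace ℝ (Fin n)) := ⟨1, 2, one_pos, one_lt_two⟩
  have hb : HasCompactSupport fun x => ((b x : ℝ) : ℂ) :=
    b.hasCompactSupport.comp_left (g := fun t : ℝ => (t : ℂ)) Complex.ofReal_zero
  let χ : 𝓢(EuclideanSpace ℝ (Fin n), ℂ) :=
    hb.toSchwartzMap (Complex.ofRealCLM.contDiff.comp b.contDiff)
  have hχ : χ 0 = 1 := by
    change ((b 0 : ℝ) : ℂ) = 1
    rw [b.one_of_mem_closedBall (by simpa using b.rIn_pos.le), Complex.ofReal_one]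
  refine DFunLike.ext _ _ fun g => ?_
  let e : Ioc (0 : ℝ) 1 → (EuclideanSpace ℝ (Fin n) ≃L[ℝ] EuclideanSpace ℝ (Fin n)) :=
    fun ε => ContinuousLinearEquiv.smulLeft (Units.mk0 (ε : ℝ) ε.2.1.ne')
  let h : Ioc (0 : ℝ) 1 → 𝓢(EuclideanSpace ℝ (Fin n), ℂ) := fun ε =>
    SchwartzMap.pairing (ContinuousLinearMap.mul ℂ ℂ)
      (SchwartzMap.compCLMOfContinuousLinearEquiv ℂ (e ε) χ) g
  have hh : Tendsto h zeroFilter (𝓝 g) :=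
    SchwartzMap.tendsto_dilate_mul χ g hχ h fun ε x => rfl
  have hhc : ∀ ε, HasCompactSupport (h ε) := fun ε =>
    (hb.comp_homeomorph (e ε).toHomeomorph).mul_right (f' := g)
  have h1 := (S.continuous.tendsto g).comp hh
  have h2 := (S'.continuous.tendsto g).comp hh
  refine tendsto_nhds_unique h1 (h2.congr fun ε => (hcpt _ (hhc ε)).symm)

theorem isTemperedExt_temperedExt {T : 𝓓'((⊤ : Opens (EuclideanSpace ℝ (Fin n))), ℂ)}
    (h : IsTempered T) : IsTemperedExt T (temperedExt T) := by
  rw [temperedExt, dif_pos h]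
  exact h.choose_spec

theorem IsTemperedExt.add {T T' : 𝓓'((⊤ : Opens (EuclideanSpace ℝ (Fin n))), ℂ)}
    {S S' : 𝓢'(EuclideanSpace ℝ (Fin n), ℂ)} (hS : IsTemperedExt T S)
    (hS' : IsTemperedExt T' S') : IsTemperedExt (T + T') (S + S') := fun θ => by
  change S _ + S' _ = T _ + T' _
  rw [hS, hS']

theorem IsTemperedExt.smul {T : 𝓓'((⊤ : Opens (EuclideanSpace ℝ (Fin n))), ℂ)}
    {S : 𝓢'(EuclideanSpace ℝ (Fin n), ℂ)} (c : ℂ) (hS : IsTemperedExt T S) :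
    IsTemperedExt (c • T) (c • S) := fun θ => by
  change c • S _ = c • T _
  rw [hS]

theorem temperedExt_add {T T' : 𝓓'((⊤ : Opens (EuclideanSpace ℝ (Fin n))), ℂ)}
    (hT : IsTempered T) (hT' : IsTempered T') :
    temperedExt (T + T') = temperedExt T + temperedExt T' := by
  have h := (isTemperedExt_temperedExt hT).add (isTemperedExt_temperedExt hT')
  exact (isTemperedExt_temperedExt ⟨_, h⟩).unique h

theorem temperedExt_smul {T : 𝓓'((⊤ : Opens (EuclideanSpace ℝ (Fin n))), ℂ)} (c : ℂ)
    (hT : IsTempered T) : temperedExt (c • T) = c • temperedExt T := by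
  have h := (isTemperedExt_temperedExt hT).smul c
  exact (isTemperedExt_temperedExt ⟨_, h⟩).unique h

theorem isTempered_of_mem_sobolev {k : ℕ∞} {p : ℝ≥0∞} [Fact (1 ≤ p)]
    {T : 𝓓'((⊤ : Opens (EuclideanSpace ℝ (Fin n))), ℂ)} (hT : T ∈ sobolev ⊤ k p) :
    IsTempered T := by
  -- The empty word says that `T` itself is an `L^p` function.
  obtain ⟨f, hf, h⟩ := hT 0 (by simp) Fin.elim0
  have hvol : (volume : Measure (EuclideanSpace ℝ (Fin n))).restrict
      ((⊤ : Opens (EuclideanSpace ℝ (Fin n))) : Set _) = volume := by simp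
  rw [hvol] at hf
  refine ⟨MeasureTheory.Lp.toTemperedDistribution (hf.toLp f), fun θ => ?_⟩
  rw [Lp.toTemperedDistribution_apply]
  have := h θ
  rw [LineDeriv.iteratedLineDerivOp_fin_zero, hvol] at this
  rw [this]
  refine integral_congr_ae ?_
  filter_upwards [hf.coeFn_toLp] with x hx
  rw [hx, testToSchwartz_apply]
  simp

end Colombeau

namespace Colombeau

/-! ### Distributions that vanish off a bounded set are tempered -/

section CutOff

variable {V : Type*} [NormedAddCommGroup V] [NormedSpace ℝ V]

/-- The part `L (χ g)`, for `L = re` or `L = im`, of a cut-off Schwartz function, as a function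
supported in a compact set. -/
noncomputable def cutOffSupportedIn (K : Compacts V) (χ : V → ℝ) (hχ : ContDiff ℝ (⊤ : ℕ∞) χ)
    (hK : EqOn χ 0 (K : Set V)ᶜ) (L : ℂ →L[ℝ] ℝ) : 𝓢(V, ℂ) →ₗ[ℝ] 𝓓_{K}(V, ℝ) where
  toFun g := ⟨fun x => χ x * L (g x), hχ.mul (L.contDiff.comp (g.smooth ⊤)), fun x hx => by
    simp [hK hx]⟩
  map_add' f g := by
    ext x
    change χ x * L (f x + g x) = χ x * L (f x) + χ x * L (g x)
    rw [map_add, mul_add]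
  map_smul' c g := by
    ext x
    change χ x * L (c • g x) = c * (χ x * L (g x))
    rw [map_smul, smul_eq_mul, mul_left_comm]

/-- The seminorms of the target are unweighted, hence bounded by Schwartz seminorms of `χ · L g`;
multiplication by `χ` and composition with `L` are continuous on Schwartz space. -/
theorem continuous_cutOffSupportedIn (K : Compacts V) (χ : V → ℝ) (hχ : ContDiff ℝ (⊤ : ℕ∞) χ)
    (hK : EqOn χ 0 (K : Set V)ᶜ) (L : ℂ →L[ℝ] ℝ) :
    Continuous (cutOffSupportedIn K χ hχ hK L) := by
  have hgrowth : χ.HasTemperateGrowth := by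
    have hc : HasCompactSupport χ := HasCompactSupport.intro K.isCompact fun x hx => hK hx
    exact (hc.toSchwartzMap hχ).hasTemperateGrowth
  let Q : 𝓢(V, ℂ) →L[ℝ] 𝓢(V, ℝ) :=
    (SchwartzMap.smulLeftCLM ℝ χ) ∘L (SchwartzMap.postcompCLM L)
  have hQ : ∀ g, ⇑(Q g) = fun x => χ x * L (g x) := fun g => by
    ext x
    simp [Q, hgrowth]
  refine WithSeminorms.continuous_of_continuous_comp
    (ContDiffMapSupportedIn.withSeminorms ℝ V ℝ ⊤ K) _ fun i => ?_
  refine Seminorm.continuous_of_le (q := (SchwartzMap.seminorm ℝ 0 i).comp Q.toLinearMap) ?_ ?_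
  · exact ((schwartz_withSeminorms ℝ V ℝ).continuous_seminorm (0, i)).comp Q.continuous
  · intro g
    change ContDiffMapSupportedIn.seminorm ℝ V ℝ ⊤ K i _ ≤ SchwartzMap.seminorm ℝ 0 i (Q g)
    rw [ContDiffMapSupportedIn.seminorm_top_le_iff ℝ (apply_nonneg _ _)]
    intro x _
    have := SchwartzMap.norm_iteratedFDeriv_le_seminorm ℝ (Q g) i x
    rw [hQ] at this
    exact this

/-- The part `L (χ g)`, for `L = re` or `L = im`, of a cut-off Schwartz function, as a test
function. -/
noncomputable def cutOff (K : Compacts V) (χ : V → ℝ) (hχ : ContDiff ℝ (⊤ : ℕ∞) χ)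
    (hK : EqOn χ 0 (K : Set V)ᶜ) (L : ℂ →L[ℝ] ℝ) :
    𝓢(V, ℂ) →L[ℝ] 𝓓((⊤ : Opens V), ℝ) :=
  (TestFunction.ofSupportedInCLM ℝ (Ω := (⊤ : Opens V)) (n := ⊤) (K := K) (fun _ _ => trivial)) ∘L
    ⟨cutOffSupportedIn K χ hχ hK L, continuous_cutOffSupportedIn K χ hχ hK L⟩

end CutOff

variable {n : ℕ}

open Distribution in
-- The extension is `g ↦ T(b g)` for a bump `b` that equals `1` on a ball containing `Uᶜ`, made
-- complex linear through real and imaginary parts.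
theorem isTempered_of_isVanishingOn {T : 𝓓'((⊤ : Opens (EuclideanSpace ℝ (Fin n))), ℂ)}
    {U : Set (EuclideanSpace ℝ (Fin n))} (hU : Bornology.IsBounded Uᶜ)
    (hT : IsVanishingOn T U) : IsTempered T := by
  obtain ⟨R, hR0, hR⟩ : ∃ R, 0 < R ∧ Uᶜ ⊆ Metric.ball (0 : EuclideanSpace ℝ (Fin n)) R := by
    obtain ⟨R, hR⟩ := hU.subset_ball 0
    exact ⟨max R 1, by positivity, hR.trans (Metric.ball_subset_ball (le_max_left _ _))⟩
  let b : ContDiffBump (0 : EuclideanSpace ℝ (Fin n)) := ⟨R, R + 1, hR0, by linarith⟩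
  let K : Compacts (EuclideanSpace ℝ (Fin n)) :=
    ⟨Metric.closedBall 0 (R + 1), isCompact_closedBall _ _⟩
  have hK : EqOn b 0 (K : Set (EuclideanSpace ℝ (Fin n)))ᶜ := fun x hx => by
    refine b.zero_of_le_dist ?_
    by_contra h
    exact hx (Metric.mem_closedBall.2 (not_le.1 h).le)
  let re := cutOff K b b.contDiff hK Complex.reCLM
  let im := cutOff K b b.contDiff hK Complex.imCLM
  have hre : ∀ (c : ℂ) g, re (c • g) = c.re • re g - c.im • im g := fun c g => by
    ext x
    change b x * (c * g x).re = c.re * (b x * (g x).re) - c.im * (b x * (g x).im)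
    rw [Complex.mul_re]
    ring
  have him : ∀ (c : ℂ) g, im (c • g) = c.re • im g + c.im • re g := fun c g => by
    ext x
    change b x * (c * g x).im = c.re * (b x * (g x).im) + c.im * (b x * (g x).re)
    rw [Complex.mul_im]
    ring
  let S : 𝓢(EuclideanSpace ℝ (Fin n), ℂ) →L[ℂ] ℂ :=
    { toFun := fun g => T (re g) + Complex.I * T (im g)
      map_add' := fun f g => by
        rw [map_add, map_add, map_add, map_add]
        ring
      map_smul' := fun c g => by
        rw [hre, him, map_sub, map_add, map_smul, map_smul, map_smul, map_smul, RingHom.id_apply]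
        simp only [Complex.real_smul, smul_eq_mul]
        conv_rhs => rw [← Complex.re_add_im c]
        linear_combination (-(c.im : ℂ) * T (im g)) * Complex.I_mul_I
      cont := (T.continuous.comp re.continuous).add
        (continuous_const.mul (T.continuous.comp im.continuous)) }
  refine ⟨S, fun θ => ?_⟩
  have h1 : im (testToSchwartz θ) = 0 := by
    ext x
    change b x * (θ x : ℂ).im = 0
    rw [Complex.ofReal_im, mul_zero]
  -- `b θ - θ` is zero on the ball, so its support lies in `U`, where `T` vanishes.
  have h2 : T (re (testToSchwartz θ) - θ) = 0 := by
    refine hT _ ?_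
    have hsub : tsupport (re (testToSchwartz θ) - θ) ⊆ (Metric.ball 0 R)ᶜ := by
      refine closure_minimal (fun x hx hxR => hx ?_) Metric.isOpen_ball.isClosed_compl
      change b x * (θ x : ℂ).re - θ x = 0
      rw [b.one_of_mem_closedBall (Metric.ball_subset_closedBall hxR), Complex.ofReal_re, one_mul,
        sub_self]
    exact hsub.trans (compl_subset_comm.1 hR)
  change T (re (testToSchwartz θ)) + Complex.I * T (im (testToSchwartz θ)) = T θ
  rw [h1, map_zero, mul_zero, add_zero]
  rw [map_sub, sub_eq_zero] at h2
  exact h2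

end Colombeau

namespace Colombeau

variable {n : ℕ} {Ω Ω' : Opens (EuclideanSpace ℝ (Fin n))}

/-! ### The extension of `E` to `ℱ'(Ω)` -/

/-- A bounded `Ω` has finite measure, so `L^p ⊆ L^1`. -/
theorem sobolev_le_sobolev_zero_one (hbdd : Bornology.IsBounded (Ω : Set (EuclideanSpace ℝ (Fin n))))
    (k : ℕ∞) (p : ℝ≥0∞) [hp : Fact (1 ≤ p)] : sobolev Ω k p ≤ sobolev Ω 0 1 := by
  intro T hT j hj w
  have : IsFiniteMeasure (volume.restrict (Ω : Set (EuclideanSpace ℝ (Fin n)))) :=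
    ⟨by rw [Measure.restrict_apply_univ]; exact hbdd.measure_lt_top⟩
  obtain ⟨f, hf, h⟩ := hT j (hj.trans zero_le) w
  exact ⟨f, hf.mono_exponent hp.out, h⟩

theorem FDist_eq (hbdd : Bornology.IsBounded (Ω : Set (EuclideanSpace ℝ (Fin n)))) :
    FDist Ω Ω' = compactDist Ω Ω' ⊔ sobolev Ω 0 1 := by
  rw [FDist]
  congr 1
  refine le_antisymm (iSup_le fun k => iSup_le fun p => iSup_le fun hp =>
    sobolev_le_sobolev_zero_one hbdd k p) ?_
  exact le_iSup_of_le 0 (le_iSup_of_le 1 (le_iSup_of_le inferInstance le_rfl))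

theorem compactDist_le_FDist : compactDist Ω Ω' ≤ FDist Ω Ω' := le_sup_left

theorem sobolev_le_FDist (k : ℕ∞) (p : ℝ≥0∞) [hp : Fact (1 ≤ p)] :
    sobolev Ω k p ≤ FDist Ω Ω' :=
  le_sup_of_le_right (le_iSup_of_le k (le_iSup_of_le p (le_iSup_of_le hp le_rfl)))

theorem exists_eq_add_of_FDist (hbdd : Bornology.IsBounded (Ω : Set (EuclideanSpace ℝ (Fin n))))
    (u : FDist Ω Ω') : ∃ a b : FDist Ω Ω', (a : 𝓓'(Ω, ℂ)) ∈ compactDist Ω Ω' ∧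
      (b : 𝓓'(Ω, ℂ)) ∈ sobolev Ω 0 1 ∧ u = a + b := by
  have hu : (u : 𝓓'(Ω, ℂ)) ∈ compactDist Ω Ω' ⊔ sobolev Ω 0 1 := by
    rw [← FDist_eq hbdd]
    exact u.2
  obtain ⟨a, ha, b, hb, h⟩ := Submodule.mem_sup.1 hu
  exact ⟨⟨a, compactDist_le_FDist ha⟩, ⟨b, sobolev_le_FDist 0 1 hb⟩, ha, hb, Subtype.ext h.symm⟩

section Extension

variable {E : 𝓓'(Ω, ℂ) → 𝓓'((⊤ : Opens (EuclideanSpace ℝ (Fin n))), ℂ)}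

theorem exists_extendsOp (hbdd : Bornology.IsBounded (Ω : Set (EuclideanSpace ℝ (Fin n))))
    (hE : IsTotalExtension Ω Ω' E) :
    ∃ Ê : FDist Ω Ω' →ₗ[ℂ] 𝓓'((⊤ : Opens (EuclideanSpace ℝ (Fin n))), ℂ), ExtendsOp E Ê := by
  let f : 𝓓'(Ω, ℂ) →ₗ.[ℂ] 𝓓'((⊤ : Opens (EuclideanSpace ℝ (Fin n))), ℂ) :=
    ⟨compactDist Ω Ω',
      { toFun := fun u => E u
        map_add' := fun u v => hE.compact_add u u.2 v v.2
        map_smul' := fun c u => hE.compact_smul c u u.2 }⟩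
  let g : 𝓓'(Ω, ℂ) →ₗ.[ℂ] 𝓓'((⊤ : Opens (EuclideanSpace ℝ (Fin n))), ℂ) :=
    ⟨sobolev Ω 0 1,
      { toFun := fun u => E u
        map_add' := fun u v => hE.sobolev_add 0 1 u u.2 v v.2
        map_smul' := fun c u => hE.sobolev_smul 0 1 c u u.2 }⟩
  -- Compatibility on the intersection is immediate because both partial maps are restrictions of
  -- the single map `E`.
  have hfg : ∀ (x : f.domain) (y : g.domain), (x : 𝓓'(Ω, ℂ)) = y → f x = g y := fun x y h =>
    congrArg E h
  refine ⟨(f.sup g hfg).toFun ∘ₗ Submodule.inclusion (FDist_eq hbdd).le, fun u hu => ?_,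
    fun k p _ u hu => ?_⟩
  · exact ((f.left_le_sup g hfg).2 (x := ⟨u, hu⟩) rfl).symm
  · exact ((f.right_le_sup g hfg).2
      (x := ⟨u, sobolev_le_sobolev_zero_one hbdd k p hu⟩) rfl).symm

variable {Ê : FDist Ω Ω' →ₗ[ℂ] 𝓓'((⊤ : Opens (EuclideanSpace ℝ (Fin n))), ℂ)}

theorem ExtendsOp.unique (hbdd : Bornology.IsBounded (Ω : Set (EuclideanSpace ℝ (Fin n))))
    {Ê' : FDist Ω Ω' →ₗ[ℂ] 𝓓'((⊤ : Opens (EuclideanSpace ℝ (Fin n))), ℂ)}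
    (h : ExtendsOp E Ê) (h' : ExtendsOp E Ê') : Ê = Ê' := by
  refine LinearMap.ext fun u => ?_
  obtain ⟨a, b, ha, hb, rfl⟩ := exists_eq_add_of_FDist hbdd u
  rw [map_add, map_add, h.1 a ha, h'.1 a ha, h.2 0 1 b hb, h'.2 0 1 b hb]

theorem ExtendsOp.isTempered (hbdd : Bornology.IsBounded (Ω : Set (EuclideanSpace ℝ (Fin n))))
    (hE : IsTotalExtension Ω Ω' E) (h : ExtendsOp E Ê) (u : FDist Ω Ω') : IsTempered (Ê u) := by
  obtain ⟨a, b, ha, hb, rfl⟩ := exists_eq_add_of_FDist hbdd u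
  rw [map_add, h.1 a ha, h.2 0 1 b hb]
  -- `Ωᶜ ⊆ U` means `Uᶜ ⊆ Ω`, which is bounded.
  obtain ⟨U, -, hU, hvan⟩ := hE.compact_vanish a ha
  obtain ⟨S, hS⟩ := isTempered_of_isVanishingOn (hbdd.subset (compl_subset_comm.1 hU)) hvan
  obtain ⟨S', hS'⟩ := isTempered_of_mem_sobolev (hE.sobolev_mem 0 1 b hb)
  exact ⟨_, hS.add hS'⟩

theorem ExtendsOp.restrictsTo (hbdd : Bornology.IsBounded (Ω : Set (EuclideanSpace ℝ (Fin n))))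
    (hE : IsTotalExtension Ω Ω' E) (h : ExtendsOp E Ê) (u : FDist Ω Ω') :
    RestrictsTo (Ê u) (u : 𝓓'(Ω, ℂ)) := by
  obtain ⟨a, b, ha, hb, rfl⟩ := exists_eq_add_of_FDist hbdd u
  rw [map_add, h.1 a ha, h.2 0 1 b hb]
  intro θ
  change E a _ + E b _ = (a : 𝓓'(Ω, ℂ)) θ + (b : 𝓓'(Ω, ℂ)) θ
  rw [hE.compact_restrict a ha θ, hE.sobolev_restrict 0 1 b hb θ]

end Extension

/-! ### Restrictions of smooth functions to `Ω̄` -/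

theorem ext0_restrict {F : EuclideanSpace ℝ (Fin n) → ℂ} {x : EuclideanSpace ℝ (Fin n)}
    (hx : x ∈ Cl Ω) : ext0 (fun y : Cl Ω => F y) x = F x :=
  Subtype.val_injective.extend_apply (fun y : Cl Ω => F y) 0 ⟨x, hx⟩

theorem partialD_ext0_restrict {F : EuclideanSpace ℝ (Fin n) → ℂ} {j : ℕ} (w : Fin j → Fin n)
    {x : EuclideanSpace ℝ (Fin n)} (hx : x ∈ Ω) :
    partialD w (ext0 (fun y : Cl Ω => F y)) x = partialD w F x := by
  have h : ext0 (fun y : Cl Ω => F y) =ᶠ[𝓝 x] F := by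
    filter_upwards [Ω.isOpen.mem_nhds hx] with y hy
    exact ext0_restrict (subset_closure hy)
  rw [partialD, partialD, (h.iteratedFDeriv ℝ j).eq_of_nhds]

theorem restrict_mem_CInf (hbdd : Bornology.IsBounded (Ω : Set (EuclideanSpace ℝ (Fin n))))
    {F : EuclideanSpace ℝ (Fin n) → ℂ} (hF : ContDiff ℝ (⊤ : ℕ∞) F) :
    (fun x : Cl Ω => F x) ∈ CInf Ω := by
  -- Compactness of the closure makes the continuous derivatives bounded, as `CInf` demands.
  have : CompactSpace (Cl Ω) := isCompact_iff_compactSpace.1 hbdd.isCompact_closure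
  refine ⟨hF.continuous.comp continuous_subtype_val, ?_, fun j w => ?_⟩
  · exact hF.contDiffOn.congr fun x hx => ext0_restrict (subset_closure hx)
  · have hc : Continuous fun x : Cl Ω => partialD w F x := by
      have h1 : Continuous (iteratedFDeriv ℝ j F) :=
        hF.continuous_iteratedFDeriv (mod_cast le_top)
      exact ((ContinuousMultilinearMap.apply ℝ _ ℂ (dirs w)).continuous.comp h1).comp
        continuous_subtype_val
    exact ⟨BoundedContinuousFunction.mkOfCompact ⟨_, hc⟩,
      fun x hx => (partialD_ext0_restrict w hx).symm⟩

theorem IsOrder.finset_sup {V ι : Type*} [AddCommGroup V] [Module ℂ V] (s : Finset ι)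
    (p : ι → Seminorm ℂ V) {u : Ioc (0 : ℝ) 1 → V}
    (h : ∀ i ∈ s, ∃ a : ℝ, IsOrder (fun ε => p i (u ε)) a) :
    ∃ a : ℝ, IsOrder (fun ε => s.sup p (u ε)) a := by
  induction s using Finset.cons_induction with
  | empty => exact ⟨0, IsBigO.of_bound 0 (Eventually.of_forall fun ε => by simp)⟩
  | cons i s hi ih =>
    obtain ⟨a, ha⟩ := h i (Finset.mem_cons_self i s)
    obtain ⟨b, hb⟩ := ih fun j hj => h j (Finset.mem_cons_of_mem hj)
    refine ⟨min a b, IsBigO.trans (IsBigO.of_bound 1 (Eventually.of_forall fun ε => ?_))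
      (IsBigO.add (ha.mono (min_le_left _ _)) (hb.mono (min_le_right _ _)))⟩
    have h1 := apply_nonneg (p i) (u ε)
    have h2 := apply_nonneg (s.sup p) (u ε)
    rw [Finset.sup_cons, one_mul, Real.norm_of_nonneg (apply_nonneg _ _),
      Real.norm_of_nonneg (add_nonneg h1 h2), Seminorm.sup_apply]
    exact max_le (le_add_of_nonneg_right h2) (le_add_of_nonneg_left h1)

theorem norm_le_muCl_zero (f : CInf Ω) {x : EuclideanSpace ℝ (Fin n)} (hx : x ∈ Ω) :
    ‖f.1 ⟨x, subset_closure hx⟩‖ ≤ muCl Ω 0 f := by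
  have h1 : supSeminorm Ω (Fin.elim0 : Fin 0 → Fin n) f ≤ muCl Ω 0 f := by
    refine le_trans ?_ (Seminorm.le_def.1 (Finset.le_sup (f := fun j => Finset.univ.sup
      fun w : Fin j → Fin n => supSeminorm Ω w) (Finset.self_mem_range_succ 0)) f)
    exact Seminorm.le_def.1 (Finset.le_sup (f := fun w : Fin 0 → Fin n => supSeminorm Ω w)
      (Finset.mem_univ Fin.elim0)) f
  refine le_trans ?_ h1
  refine le_trans (le_of_eq ?_) (le_ciSup (CInf.bdd f (Fin.elim0 : Fin 0 → Fin n)) ⟨x, hx⟩)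
  simp only [partialD, iteratedFDeriv_zero_apply]
  congr 1
  exact (Subtype.val_injective.extend_apply f.1 0 ⟨x, subset_closure hx⟩).symm

/-! ### The embedding -/

theorem schwartzConv_eq (T : 𝓓'((⊤ : Opens (EuclideanSpace ℝ (Fin n))), ℂ))
    (φ : 𝓢(EuclideanSpace ℝ (Fin n), ℂ)) (x : EuclideanSpace ℝ (Fin n)) :
    schwartzConv T φ x = temperedExt T ((reflectAt φ 0).compSubConstCLM ℂ x) := by
  rw [schwartzConv, reflectAt_eq_translate]

theorem contDiff_schwartzConv (T : 𝓓'((⊤ : Opens (EuclideanSpace ℝ (Fin n))), ℂ))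
    (φ : 𝓢(EuclideanSpace ℝ (Fin n), ℂ)) : ContDiff ℝ (⊤ : ℕ∞) (schwartzConv T φ) := by
  rw [contDiff_infty]
  intro j
  simp_rw [funext (schwartzConv_eq T φ)]
  exact SchwartzMap.contDiff_translate (temperedExt T) _ j

theorem partialD_schwartzConv (T : 𝓓'((⊤ : Opens (EuclideanSpace ℝ (Fin n))), ℂ))
    (φ : 𝓢(EuclideanSpace ℝ (Fin n), ℂ)) {j : ℕ} (w : Fin j → Fin n)
    (x : EuclideanSpace ℝ (Fin n)) :
    partialD w (schwartzConv T φ) x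
      = (-1) ^ j * temperedExt T ((∂^{dirs w} (reflectAt φ 0) :
        𝓢(EuclideanSpace ℝ (Fin n), ℂ)).compSubConstCLM ℂ x) := by
  rw [partialD, funext (schwartzConv_eq T φ)]
  exact SchwartzMap.iteratedFDeriv_translate (temperedExt T) _ _ x

/-- The net `(T ∗ φ_ε)|_Ω̄`. -/
noncomputable def convNet (hbdd : Bornology.IsBounded (Ω : Set (EuclideanSpace ℝ (Fin n))))
    (φ : 𝓢(EuclideanSpace ℝ (Fin n), ℂ)) (T : 𝓓'((⊤ : Opens (EuclideanSpace ℝ (Fin n))), ℂ))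
    (ε : Ioc (0 : ℝ) 1) : CInf Ω :=
  ⟨fun x => schwartzConv T (scaled φ ε) x, restrict_mem_CInf hbdd (contDiff_schwartzConv _ _)⟩

theorem convNet_add (hbdd : Bornology.IsBounded (Ω : Set (EuclideanSpace ℝ (Fin n))))
    (φ : 𝓢(EuclideanSpace ℝ (Fin n), ℂ))
    {T T' : 𝓓'((⊤ : Opens (EuclideanSpace ℝ (Fin n))), ℂ)} (hT : IsTempered T)
    (hT' : IsTempered T') : convNet hbdd φ (T + T') = convNet hbdd φ T + convNet hbdd φ T' := by
  refine funext fun ε => Subtype.ext (funext fun x => ?_)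
  exact congr($(temperedExt_add hT hT') (reflectAt (scaled φ ε) x))

theorem convNet_smul (hbdd : Bornology.IsBounded (Ω : Set (EuclideanSpace ℝ (Fin n))))
    (φ : 𝓢(EuclideanSpace ℝ (Fin n), ℂ)) (c : ℂ)
    {T : 𝓓'((⊤ : Opens (EuclideanSpace ℝ (Fin n))), ℂ)} (hT : IsTempered T) :
    convNet hbdd φ (c • T) = c • convNet hbdd φ T := by
  refine funext fun ε => Subtype.ext (funext fun x => ?_)
  exact congr($(temperedExt_smul c hT) (reflectAt (scaled φ ε) x))

theorem convNet_mem_moderateCl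
    (hbdd : Bornology.IsBounded (Ω : Set (EuclideanSpace ℝ (Fin n))))
    (φ : 𝓢(EuclideanSpace ℝ (Fin n), ℂ)) (T : 𝓓'((⊤ : Opens (EuclideanSpace ℝ (Fin n))), ℂ)) :
    convNet hbdd φ T ∈ ModerateCl Ω := by
  intro k
  refine IsOrder.finset_sup _ _ fun j _ => IsOrder.finset_sup _ _ fun w _ => ?_
  obtain ⟨R, hR⟩ := hbdd.exists_norm_le
  obtain ⟨C, N, hC, h⟩ := exists_moderate_bound (temperedExt T) φ (dirs w) R
  -- The exponent depends on the word; `IsOrder.finset_sup` takes the minimum over the finitely many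
  -- words of order at most `k`.
  refine ⟨-N, IsBigO.of_bound C (Eventually.of_forall fun ε => ?_)⟩
  have hε : 0 < (ε : ℝ) := ε.2.1
  rw [Real.norm_of_nonneg (apply_nonneg _ _), Real.norm_of_nonneg (Real.rpow_nonneg hε.le _),
    Real.rpow_neg hε.le, Real.rpow_natCast]
  refine Real.iSup_le (fun x => ?_) (by positivity)
  have := partialD_ext0_restrict (Ω := Ω) (F := schwartzConv T (scaled φ ε)) w x.2
  refine le_trans (le_of_eq ?_) (h ε x (hR x x.2))
  change ‖partialD w (ext0 fun y : Cl Ω => schwartzConv T (scaled φ ε) y) x‖ = _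
  rw [this, partialD_schwartzConv, norm_mul, norm_pow, norm_neg, norm_one, one_pow, one_mul]
  rfl

/-- A tempered distribution whose regularizations tend to zero uniformly on `Ω` vanishes
on `Ω`. -/
theorem apply_monoCLM_eq_zero_of_tendsto {T : 𝓓'((⊤ : Opens (EuclideanSpace ℝ (Fin n))), ℂ)}
    (hT : IsTempered T) (ψ : 𝓢(EuclideanSpace ℝ (Fin n), ℂ)) (hψ : ψ 0 = 1)
    (r : Ioc (0 : ℝ) 1 → ℝ) (hr : Tendsto r zeroFilter (𝓝 0))
    (h : ∀ ε, ∀ x ∈ Ω, ‖schwartzConv T (scaled (𝓕⁻ ψ) ε) x‖ ≤ r ε) (θ : 𝓓(Ω, ℝ)) :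
    T (TestFunction.monoCLM ℝ θ) = 0 := by
  set θ' : 𝓓((⊤ : Opens (EuclideanSpace ℝ (Fin n))), ℝ) := TestFunction.monoCLM ℝ θ with hθ'
  have hθ'_apply : ∀ x, θ' x = θ x := fun x => by
    rw [hθ', TestFunction.monoCLM_apply, if_pos ⟨le_rfl, le_top⟩]
  set θs := testToSchwartz θ' with hθs
  have hcpt : HasCompactSupport θs :=
    θ'.hasCompactSupport.comp_left (g := fun t : ℝ => (t : ℂ)) Complex.ofReal_zero
  -- The same net has two limits: `T θ`, by convergence of the mollified test functions, and `0`, by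
  -- moving the mollifier onto `T`.
  have h1 : Tendsto (fun ε => temperedExt T
      (SchwartzMap.conv θs (reflectAt (scaled (𝓕⁻ ψ) ε) 0))) zeroFilter
      (𝓝 (temperedExt T θs)) :=
    ((temperedExt T).continuous.tendsto _).comp (tendsto_conv_scaled ψ θs hψ)
  have h2 : Tendsto (fun ε => temperedExt T
      (SchwartzMap.conv θs (reflectAt (scaled (𝓕⁻ ψ) ε) 0))) zeroFilter (𝓝 0) := by
    have h3 : Tendsto (fun ε => ∫ x, ‖θs x‖ * r ε) zeroFilter (𝓝 0) := by
      simp_rw [integral_mul_const]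
      simpa using hr.const_mul (∫ x, ‖θs x‖)
    refine squeeze_zero_norm (fun ε => ?_) h3
    have := SchwartzMap.integral_mul_apply_translate (temperedExt T) θs
      (reflectAt (scaled (𝓕⁻ ψ) ε) 0) hcpt
    refine (congrArg norm this.symm).le.trans ?_
    refine norm_integral_le_of_norm_le (θs.integrable.norm.mul_const _)
      (Eventually.of_forall fun x => ?_)
    rw [norm_mul]
    -- Outside `Ω` the test function is zero, so only the bound on `Ω` enters.
    by_cases hx : x ∈ Ω
    · refine mul_le_mul_of_nonneg_left ?_ (norm_nonneg _)
      have := h ε x hx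
      rwa [schwartzConv_eq] at this
    · have hx0 : θs x = 0 := by
        rw [hθs, testToSchwartz_apply, hθ'_apply,
          image_eq_zero_of_notMem_tsupport fun h => hx (θ.tsupport_subset h), Complex.ofReal_zero]
      rw [hx0, norm_zero, zero_mul, zero_mul]
  rw [← isTemperedExt_temperedExt hT θ']
  exact tendsto_nhds_unique h1 h2

end Colombeau

/-! ### The embedding into the quotient and its injectivity -/

namespace Colombeau
section
variable {V : Type*} [AddCommGroup V] [Module ℂ V]

/-- The quotient map from moderate nets to the generalized extension. -/
noncomputable def genExtMk (μ : ℕ → Seminorm ℂ V) : Moderate μ →ₗ[ℂ] GenExt μ := (Null μ).mkQ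

theorem genExtMk_eq_zero {μ : ℕ → Seminorm ℂ V} {u : Moderate μ} (h : genExtMk μ u = 0) (k : ℕ)
    (a : ℝ) : IsOrder (fun ε => μ k (u.1 ε)) a :=
  ((Submodule.Quotient.mk_eq_zero (Null μ)).1 h : u ∈ Null μ) k a

end

variable {n : ℕ} {Ω Ω' : Opens (EuclideanSpace ℝ (Fin n))}

/-- The net of regularizations of `Ê u`, as a linear map. -/
noncomputable def convNetLM (hbdd : Bornology.IsBounded (Ω : Set (EuclideanSpace ℝ (Fin n))))
    (φ : 𝓢(EuclideanSpace ℝ (Fin n), ℂ))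
    (Ê : FDist Ω Ω' →ₗ[ℂ] 𝓓'((⊤ : Opens (EuclideanSpace ℝ (Fin n))), ℂ))
    (hÊ : ∀ u, IsTempered (Ê u)) : FDist Ω Ω' →ₗ[ℂ] ModerateCl Ω where
  toFun u := ⟨convNet hbdd φ (Ê u), convNet_mem_moderateCl hbdd _ _⟩
  map_add' u v := by
    refine Subtype.ext ((congrArg (convNet hbdd φ) (map_add Ê u v)).trans ?_)
    exact convNet_add hbdd _ (hÊ u) (hÊ v)
  map_smul' c u := by
    refine Subtype.ext ((congrArg (convNet hbdd φ) (map_smul Ê c u)).trans ?_)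
    exact convNet_smul hbdd _ c (hÊ u)

/-- The embedding of `ℱ'(Ω)` into `𝒢(Ω̄)`. -/
noncomputable def embedding (hbdd : Bornology.IsBounded (Ω : Set (EuclideanSpace ℝ (Fin n))))
    (φ : 𝓢(EuclideanSpace ℝ (Fin n), ℂ))
    (Ê : FDist Ω Ω' →ₗ[ℂ] 𝓓'((⊤ : Opens (EuclideanSpace ℝ (Fin n))), ℂ))
    (hÊ : ∀ u, IsTempered (Ê u)) : FDist Ω Ω' →ₗ[ℂ] GCl Ω :=
  (genExtMk (muCl Ω)).comp (convNetLM hbdd φ Ê hÊ)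

theorem exists_embedding_eq (hbdd : Bornology.IsBounded (Ω : Set (EuclideanSpace ℝ (Fin n))))
    (φ : 𝓢(EuclideanSpace ℝ (Fin n), ℂ))
    (Ê : FDist Ω Ω' →ₗ[ℂ] 𝓓'((⊤ : Opens (EuclideanSpace ℝ (Fin n))), ℂ))
    (hÊ : ∀ u, IsTempered (Ê u)) (u : FDist Ω Ω') : ∃ N : ModerateCl Ω,
      (∀ (ε : Ioc (0 : ℝ) 1) (x : Cl Ω),
        (N.1 ε).1 x = schwartzConv (Ê u) (scaled φ ε) x) ∧
      embedding hbdd φ Ê hÊ u = classCl Ω N :=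
  ⟨convNetLM hbdd φ Ê hÊ u, fun _ _ => rfl, rfl⟩

theorem embedding_injective (hbdd : Bornology.IsBounded (Ω : Set (EuclideanSpace ℝ (Fin n))))
    (ψ : 𝓢(EuclideanSpace ℝ (Fin n), ℂ)) (hψ : ψ 0 = 1)
    (Ê : FDist Ω Ω' →ₗ[ℂ] 𝓓'((⊤ : Opens (EuclideanSpace ℝ (Fin n))), ℂ))
    (hÊ : ∀ u, IsTempered (Ê u)) (hres : ∀ u : FDist Ω Ω', RestrictsTo (Ê u) (u : 𝓓'(Ω, ℂ))) :
    Function.Injective (embedding hbdd (𝓕⁻ ψ) Ê hÊ) := by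
  rw [injective_iff_map_eq_zero]
  intro u hu
  -- Of the null condition only `k = 0`, `a = 1` is needed: the sup norm on `Ω` is `O(ε)`.
  have hr : Tendsto (fun ε => muCl Ω 0 (convNet hbdd (𝓕⁻ ψ) (Ê u) ε)) zeroFilter (𝓝 0) := by
    refine (genExtMk_eq_zero hu 0 1 : IsOrder (fun ε => muCl Ω 0 (convNet hbdd (𝓕⁻ ψ) (Ê u) ε))
      1).trans_tendsto ?_
    simpa using tendsto_zeroFilter
  refine Subtype.ext (DFunLike.ext _ _ fun θ => ?_)
  exact (hres u θ).symm.trans (apply_monoCLM_eq_zero_of_tendsto (hÊ u) ψ hψ _ hr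
    (fun ε x hx => norm_le_muCl_zero (convNet hbdd (𝓕⁻ ψ) (Ê u) ε) hx) θ)

end Colombeau

theorem theorem3p7 {n : ℕ} (Ω Ω' : Opens (EuclideanSpace ℝ (Fin n)))
    (hbdd : Bornology.IsBounded (Ω : Set (EuclideanSpace ℝ (Fin n))))
    (hsmooth : IsSmoothClass Ω)
    (hcpt : IsCompact (closure (Ω' : Set (EuclideanSpace ℝ (Fin n)))))
    (hsub : closure (Ω' : Set (EuclideanSpace ℝ (Fin n))) ⊆ Ω)
    (E : 𝓓'(Ω, ℂ) → 𝓓'((⊤ : Opens (EuclideanSpace ℝ (Fin n))), ℂ))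
    (hE : IsTotalExtension Ω Ω' E)
    (ψ : 𝓢(EuclideanSpace ℝ (Fin n), ℂ)) (hψ : ∀ᶠ ξ in 𝓝 0, ψ ξ = 1) :
    (∃! Ê : FDist Ω Ω' →ₗ[ℂ] 𝓓'((⊤ : Opens (EuclideanSpace ℝ (Fin n))), ℂ), ExtendsOp E Ê) ∧
    ∀ Ê : FDist Ω Ω' →ₗ[ℂ] 𝓓'((⊤ : Opens (EuclideanSpace ℝ (Fin n))), ℂ), ExtendsOp E Ê →
      (∀ u, IsTempered (Ê u)) ∧
      ∃ i : FDist Ω Ω' →ₗ[ℂ] GCl Ω, Function.Injective i ∧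
        ∀ u : FDist Ω Ω', ∃ N : ModerateCl Ω,
          (∀ (ε : Ioc (0 : ℝ) 1) (x : Cl Ω),
            (N.1 ε).1 x = schwartzConv (Ê u) (scaled (𝓕⁻ ψ) ε) x) ∧
          i u = classCl Ω N := by
  obtain ⟨Ê₀, h₀⟩ := exists_extendsOp hbdd hE
  refine ⟨⟨Ê₀, h₀, fun Ê h => h.unique hbdd h₀⟩, fun Ê h => ?_⟩
  have htemp := h.isTempered hbdd hE
  exact ⟨htemp, embedding hbdd (𝓕⁻ ψ) Ê htemp,
    embedding_injective hbdd ψ hψ.self_of_nhds Ê htemp (h.restrictsTo hbdd hE),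
    exists_embedding_eq hbdd (𝓕⁻ ψ) Ê htemp⟩
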